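/- **Setting.** Let $\mathcal X$ be a measurable space, $\mathcal A$ a finite set, $H,N\ge 1$ integers, and let an MDP be given by an initial distribution $d_1$ on $\mathcal X$, transition kernels $P_h$ from $\mathcal X\times\mathcal A$ to $\mathcal X$ and conditional cost distributions $C_h(x,a)$ on $[0,1]$, $h\in[H]=\{1,\dots,H\}$. A policy $\pi=(\pi_1,\dots,\pi_H)$ consists of kernels $\pi_h$ from $\mathcal X$ to $\mathcal A$. Rolling in $\pi$ means: $x_1\sim d_1$ and, for $h=1,\dots,H$, $a_h\sim\pi_h(x_h)$ and, independently given $(x_h,a_h)$, $c_h\sim C_h(x_h,a_h)$ and $x_{h+1}\sim P_h(x_h,a_h)$. Let $d_h^\pi$ be the law of $(x_h,a_h)$, $Z^\pi=\sum_{h=1}^H c_h$ the return and $V^\pi=\mathbb E[Z^\pi]$. Given probability distributions $\nu_1,\dots,\nu_H$ on $\mathcal X\times\mathcal A$, put $C^\pi=\max_h\|\mathrm d d_h^\pi/\mathrm d\nu_h\|_\infty$, with $C^\pi=\infty$ if $d^\pi_h\not\ll\nu_h$ for some $h$. Fix a measure $\lambda$ on $\mathbb R$. Let $\Pi$ be a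 finite non-empty set of policies and $\mathcal F=\mathcal F_1\times\dots\times\mathcal F_H$, where each $\mathcal F_h$ is a finite set of conditional distributions $f(\cdot\mid x,a)$ on $[0,1]$ with densities with respect to $\lambda$; let $\mathcal F_{H+1}$ consist of the point mass at $0$ alone. For a conditional distribution $d$, let $\mathcal T_h^{\pi,D}d(x,a)$ be the law of $c+y$, where $c\sim C_h(x,a)$, $x'\sim P_h(x,a)$ are independent, $a'\sim\pi_{h+1}(x')$ and $y\sim d(x',a')$ (for $h=H$: $y=0$). Bellman completeness means: for all $\pi\in\Pi$, $h\in[H]$ and $f_{h+1}\in\mathcal F_{h+1}$ we have $\mathcal T_h^{\pi,D}f_{h+1}\in\mathcal F_h$. (Then returns of policies in $\Pi$ lie in $[0,1]$ almost surely.) **P-DISCO.** The data are, for each $h\in[H]$, $N$ i.i.d. samples $(x_{h,i},a_{h,i},c_{h,i},x'_{h,i})$ with $(x_{h,i},a_{h,i})\sim\nu_h$ and, independently given these, $c_{h,i}\sim C_h(x_{h,i},a_{h,i})$ and $x'_{h,i}\sim P_h(x_{h,i},a_{h,i})$. For $\pi\in\Pi$, $f\in\mathcal F$, $h\in[H]$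 and $i\in[N]$ the learner draws $a'\sim\pi_{h+1}(x'_{h,i})$, $y\sim f_{h+1}(x'_{h,i},a')$ (with $y=0$ if $h=H$), independently over $i$, and sets $z^{\pi,f}_{h,i}=c_{h,i}+y$. For a threshold $\beta$ let $$\mathcal F_\pi=\Big\{f\in\mathcal F:\ \forall h\in[H],\ \sum_{i=1}^N\log f_h(z^{\pi,f}_{h,i}\mid x_{h,i},a_{h,i})\ \ge\ \max_{g\in\mathcal F_h}\sum_{i=1}^N\log g(z^{\pi,f}_{h,i}\mid x_{h,i},a_{h,i})-\beta\Big\},$$ with $\log 0=-\infty$. Writing $\bar f_1(x,\pi)=\mathbb E_{a\sim\pi_1(x)}$ of the mean of $f_1(\cdot\mid x,a)$, let $f^\pi\in\arg\max_{f\in\mathcal F_\pi}\mathbb E_{x_1\sim d_1}[\bar f_1(x_1,\pi)]$ for each $\pi\in\Pi$. P-DISCO returns $\hat\pi\in\arg\min_{\pi\in\Pi}\mathbb E_{x_1\sim d_1}[\bar f^\pi_1(x_1,\pi)]$, with ties broken arbitrarily. **Theorem (second-order bounds for offline RL).** There is a universal constant $K>0$ such that the following holds in every setting as above that satisfies Bellman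 completeness. Let $\delta\in(0,1)$ and $\beta=\log(H|\Pi||\mathcal F|/\delta)$. Then with probability at least $1-\delta$, all the sets $\mathcal F_\pi$, $\pi\in\Pi$, are non-empty, so that P-DISCO with threshold $\beta$ returns a policy, and every policy $\hat\pi$ it may return satisfies, for every $\tilde\pi\in\Pi$ with $C^{\tilde\pi}<\infty$, $$V^{\hat\pi}-V^{\tilde\pi}\ \le\ K\left(H\sqrt{\frac{\operatorname{Var}(Z^{\tilde\pi})\,C^{\tilde\pi}\,\beta}{N}}+\frac{H^{2.5}\,C^{\tilde\pi}\,\beta}{N}\right).$$ -/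

import Mathlib

open MeasureTheory ProbabilityTheory
open scoped ENNReal NNReal

namespace OfflineDistRL

/-- A conditional distribution on `[0,1]` given a state and an action, with a density with respect
to the dominating measure `ρ`. The density is a fixed, jointly measurable version; it is what the
log-likelihood evaluates. -/
structure CondDist (X A : Type*) [MeasurableSpace X] [MeasurableSpace A] (ρ : Measure ℝ) where
  kernel : Kernel (X × A) ℝ
  density : X × A → ℝ → ℝ≥0
  isMarkov : IsMarkovKernel kernel
  measurable_density : Measurable (Function.uncurry density)
  kernel_eq : ∀ p, kernel p = ρ.withDensity (fun y => (density p y : ℝ≥0∞))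
  mem_unit : ∀ p, ∀ᵐ y ∂(kernel p), y ∈ Set.Icc (0 : ℝ) 1

/-- A (possibly randomized, possibly time-dependent) Markov policy with horizon `H`. -/
structure Policy (H : ℕ) (X A : Type*) [MeasurableSpace X] [MeasurableSpace A] where
  act : Fin H → Kernel X A
  isMarkov : ∀ h, IsMarkovKernel (act h)

/-- A finite-horizon Markov decision process; step `h : Fin H` stands for step `h + 1` of
`1, …, H`. The initial state is drawn from `init`. -/
structure MDP (H : ℕ) (X A : Type*) [MeasurableSpace X] [MeasurableSpace A] where
  init : Measure X
  trans : Fin H → Kernel (X × A) X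
  cost : Fin H → Kernel (X × A) ℝ
  init_isProbability : IsProbabilityMeasure init
  trans_isMarkov : ∀ h, IsMarkovKernel (trans h)
  cost_isMarkov : ∀ h, IsMarkovKernel (cost h)
  cost_mem_unit : ∀ h p, ∀ᵐ c ∂(cost h p), c ∈ Set.Icc (0 : ℝ) 1

noncomputable section

variable {H N : ℕ} {X A : Type*} [MeasurableSpace X] [MeasurableSpace A] {ρ : Measure ℝ}

/-- The joint law of `(x_{n+1}, c_1 + ⋯ + c_n)` when rolling in `π` from `x_1 ∼ init`: in each
step `a ∼ π_h(x)`, then independently `c ∼ C_h(x,a)` and `x' ∼ P_h(x,a)`, and `(x, s)` becomes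
`(x', s + c)`. -/
def rollIn (M : MDP H X A) (π : Policy H X A) : ℕ → Measure (X × ℝ)
  | 0 => M.init.prod (Measure.dirac 0)
  | n + 1 =>
    if hn : n < H then
      ((rollIn M π n ⊗ₘ (π.act ⟨n, hn⟩).comap Prod.fst measurable_fst) ⊗ₘ
        (M.cost ⟨n, hn⟩ ×ₖ M.trans ⟨n, hn⟩).comap
          (fun q : (X × ℝ) × A => (q.1.1, q.2)) (by fun_prop)).map
        (fun q => (q.2.2, q.1.1.2 + q.2.1))
    else rollIn M π n

/-- The occupancy measure `d^π_h`: the law of `(x_h, a_h)` under `π`. -/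
def occupancy (M : MDP H X A) (π : Policy H X A) (h : Fin H) : Measure (X × A) :=
  (rollIn M π h).map Prod.fst ⊗ₘ π.act h

/-- The law of the return `Z^π = c_1 + ⋯ + c_H`, with `x_1 ∼ init`. -/
def returnLaw (M : MDP H X A) (π : Policy H X A) : Measure ℝ :=
  (rollIn M π H).map Prod.snd

/-- The value `V^π`, the mean of the return. -/
def value (M : MDP H X A) (π : Policy H X A) : ℝ := ∫ z, z ∂(returnLaw M π)

/-- The variance of the return `Z^π`. -/
def returnVar (M : MDP H X A) (π : Policy H X A) : ℝ := Var[id; returnLaw M π]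

open Classical in
/-- Single-policy concentrability `max_h ‖d d^π_h / d ν_h‖_∞`, which is `∞` if some `d^π_h` is
not absolutely continuous with respect to `ν_h`. -/
def concentrability (M : MDP H X A) (ν : Fin H → Measure (X × A)) (π : Policy H X A) : ℝ≥0∞ :=
  ⨆ h, if occupancy M π h ≪ ν h then essSup ((occupancy M π h).rnDeriv (ν h)) (ν h) else ∞

/-- `x ↦` the law of `y` when `a ∼ π(x)` and `y ∼ d(x,a)`. -/
def follow (π : Kernel X A) (d : Kernel (X × A) ℝ) : Kernel X ℝ :=
  d ∘ₖ (Kernel.id ×ₖ π)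

/-- The cost-to-go after the last step is `0`. -/
def terminal : Kernel X ℝ := Kernel.const X (Measure.dirac 0)

/-- The distributional Bellman backup: the law of `c + y` for independent `c ∼ C_h(x,a)` and
`x' ∼ P_h(x,a)`, and `y ∼ κ(x')`. For `κ = follow π_{h+1} d` this is the distributional
Bellman operator of `π` applied to `d`. -/
def bellman (M : MDP H X A) (h : Fin H) (κ : Kernel X ℝ) : Kernel (X × A) ℝ :=
  (M.cost h ×ₖ (κ ∘ₖ M.trans h)).map (fun p => p.1 + p.2)

/-- Distributional Bellman completeness of the classes `F_1, …, F_H` for all policies in `Π`,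
where `F_{H+1}` consists of the point mass at `0`. -/
structure BellmanComplete (M : MDP H X A) (Pi : Finset (Policy H X A))
    (F : Fin H → Finset (CondDist X A ρ)) : Prop where
  step : ∀ π ∈ Pi, ∀ (h : Fin H) (hh : (h : ℕ) + 1 < H), ∀ d ∈ F ⟨h + 1, hh⟩,
    ∃ g ∈ F h, g.kernel = bellman M h (follow (π.act ⟨h + 1, hh⟩) d.kernel)
  last : ∀ h : Fin H, (h : ℕ) + 1 = H → ∃ g ∈ F h, g.kernel = bellman M h terminal

/-- The law of a sample `y` of the candidate cost-to-go `f_{h+1}` from the next state,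
with the next action taken by `π`; zero after the last step. -/
def continuation (π : Policy H X A) (f : Fin H → CondDist X A ρ) (h : Fin H) : Kernel X ℝ :=
  if hh : (h : ℕ) + 1 < H then follow (π.act ⟨h + 1, hh⟩) (f ⟨h + 1, hh⟩).kernel else terminal

/-- The realized input of the algorithm: the transitions `((x,a), c, x')` for each step and
sample index, and the learner's own draws `y` made for each `π` and `f`. -/
structure Dataset (H N : ℕ) (X A : Type*) [MeasurableSpace X] [MeasurableSpace A]
    (ρ : Measure ℝ) where
  xa : Fin H → Fin N → X × A
  c : Fin H → Fin N → ℝ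
  next : Fin H → Fin N → X
  y : Policy H X A → (Fin H → CondDist X A ρ) → Fin H → Fin N → ℝ

/-- The law of one sample `((x,a), (c, x'), y)` at step `h`: `(x,a) ∼ ν_h`, independently
`c ∼ C_h(x,a)` and `x' ∼ P_h(x,a)`, and then `y ∼ continuation π f h x'`. -/
def sampleLaw (M : MDP H X A) (ν : Fin H → Measure (X × A)) (π : Policy H X A)
    (f : Fin H → CondDist X A ρ) (h : Fin H) : Measure ((X × A) × (ℝ × X) × ℝ) :=
  ν h ⊗ₘ ((M.cost h ×ₖ M.trans h) ⊗ₖ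
    (continuation π f h).comap (fun q : (X × A) × (ℝ × X) => q.2.2) (by fun_prop))

/-- `D` is a random dataset as in offline RL: for each step `h`, and each `π` and `f` that the
algorithm considers, the `N` samples are i.i.d. No assumption is made on the joint law of the
samples of different steps, or of the draws `y` for different `π` and `f`. -/
def IsOfflineData {Ω : Type*} [MeasurableSpace Ω] (P : Measure Ω) (M : MDP H X A)
    (ν : Fin H → Measure (X × A)) (Pi : Finset (Policy H X A))
    (F : Fin H → Finset (CondDist X A ρ)) (D : Ω → Dataset H N X A ρ) : Prop :=
  ∀ π ∈ Pi, ∀ f ∈ Fintype.piFinset F, ∀ h : Fin H,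
    let s : Fin N → Ω → (X × A) × (ℝ × X) × ℝ :=
      fun i ω => ((D ω).xa h i, ((D ω).c h i, (D ω).next h i), (D ω).y π f h i)
    (∀ i, Measurable (s i)) ∧ iIndepFun s P ∧ ∀ i, P.map (s i) = sampleLaw M ν π f h

/-- The log-likelihood `∑_i log g(z_i ∣ x_{h,i}, a_{h,i})` at step `h` of a candidate `g` on the
targets `z_i = c_{h,i} + y_i` drawn for `π` and `f`. Here `log 0 = -∞`. -/
def logLik (D : Dataset H N X A ρ) (π : Policy H X A) (f : Fin H → CondDist X A ρ) (h : Fin H)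
    (g : CondDist X A ρ) : EReal :=
  ∑ i, ENNReal.log (g.density (D.xa h i) (D.c h i + D.y π f h i) : ℝ≥0∞)

/-- The maximum likelihood confidence set for `π` with threshold `β`, in `F = F_1 × ⋯ × F_H`. -/
def confSet (F : Fin H → Finset (CondDist X A ρ)) (β : ℝ) (D : Dataset H N X A ρ)
    (π : Policy H X A) : Set (Fin H → CondDist X A ρ) :=
  {f | f ∈ Fintype.piFinset F ∧
    ∀ h, (⨆ g ∈ F h, logLik D π f h g) - (β : EReal) ≤ logLik D π f h (f h)}

/-- The estimate `E_{x ∼ init} E_{a ∼ π_1(x)} [mean of f_1(x,a)]` of the value of `π`. -/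
def estimate [NeZero H] (M : MDP H X A) (π : Policy H X A) (f : Fin H → CondDist X A ρ) : ℝ :=
  ∫ x, ∫ a, ∫ y, y ∂((f 0).kernel (x, a)) ∂(π.act 0 x) ∂M.init

/-- `πhat` is an output of P-DISCO on `D`, under some way of breaking ties: `sel π` maximizes the
value estimate over the confidence set of `π`, and `πhat` minimizes the resulting pessimistic
estimate over `Π`. -/
def IsPDiscoOutput [NeZero H] (M : MDP H X A) (Pi : Finset (Policy H X A))
    (F : Fin H → Finset (CondDist X A ρ)) (β : ℝ) (D : Dataset H N X A ρ)
    (πhat : Policy H X A) : Prop :=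
  ∃ sel : Policy H X A → Fin H → CondDist X A ρ,
    (∀ π ∈ Pi, sel π ∈ confSet F β D π ∧
      ∀ f ∈ confSet F β D π, estimate M π f ≤ estimate M π (sel π)) ∧
    πhat ∈ Pi ∧ ∀ π ∈ Pi, estimate M πhat (sel πhat) ≤ estimate M π (sel π)

end

end OfflineDistRL

/-! Pessimism reduces the regret to a statement about the comparator alone. If every `confSet`
contains the true conditional return laws of its policy, then maximising the estimate over `confSet`
overestimates each value, so the value of the output is at most its own estimate, hence at most the
estimate selected for the comparator. What remains is to bound how far that last estimate exceeds
the comparator's value, and only the comparator's concentrability enters.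

The excess is controlled through the squared Hellinger distance `hell`. For laws on the unit
interval at distance `D`, the means differ by at most a multiple of `√(Var * D) + D`, where the
variance is that of either one of the two laws (`abs_mean_sub_le_hell`); taking the true return law
gives the second-order form. The distance between predicted and true return laws is bounded by the
Bellman errors of the candidate along the occupancy measures: the distributional backup does not
expand averaged `hell`, and a triangle inequality with step-dependent weights lets the error grow
only like `H ^ 2` (`lintegral_hell_fixed_le`). Concentrability transfers the Bellman errors to the
data distribution.

The Bellman errors are small by likelihood ratio tests against the true backup `g` of a candidate
`f`. A ratio of any density to that of `g` has mean at most one, so Markov's inequality keeps the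
truth in the confidence set (`IsOfflineData.measure_lik_lt_le`). The square root of the ratio of `f`
to `g` has mean `(1 - D / 2) ^ N`, so a candidate with `D > 5 * β / N` survives with probability at
most `exp (-2 * β)` (`IsOfflineData.measure_lik_le_le`). Completeness makes `g` a competitor in the
class, and a union bound finishes. -/

namespace OfflineDistRL

noncomputable section

/-! ### Hellinger distance: variational form, densities, comparison of means. -/

section Hellinger

variable {α : Type*} [MeasurableSpace α]

/-- Twice the Bhattacharyya affinity, in variational form. -/
def affinity (μ ν : Measure α) : ℝ≥0∞ :=
  ⨅ (φ : α → ℝ≥0∞) (_ : Measurable φ), ∫⁻ y, φ y ∂μ + ∫⁻ y, (φ y)⁻¹ ∂ν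

/-- The squared Hellinger distance `∫ (√u - √v)²` of two probability measures. -/
def hell (μ ν : Measure α) : ℝ≥0∞ := 2 - affinity μ ν

lemma affinity_le {μ ν : Measure α} {φ : α → ℝ≥0∞} (hφ : Measurable φ) :
    affinity μ ν ≤ ∫⁻ y, φ y ∂μ + ∫⁻ y, (φ y)⁻¹ ∂ν :=
  iInf₂_le φ hφ

lemma affinity_le_two (μ ν : Measure α) [IsProbabilityMeasure μ] [IsProbabilityMeasure ν] :
    affinity μ ν ≤ 2 := by
  refine (affinity_le (φ := fun _ => 1) measurable_const).trans ?_
  simp [one_add_one_eq_two]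

/-- AM-GM for `u * φ` and `v * φ⁻¹`; at `φ = 0` and `φ = ∞` the conventions `0⁻¹ = ∞` and `0 * ∞ =
0` keep it true. -/
lemma two_mul_sqrt_mul_le (u v : ℝ≥0) (φ : ℝ≥0∞) :
    2 * (NNReal.sqrt (u * v) : ℝ≥0∞) ≤ u * φ + v * φ⁻¹ := by
  rcases eq_or_ne φ 0 with rfl | h0
  · rcases eq_or_ne v 0 with rfl | hv
    · simp
    · simp [ENNReal.mul_top, hv]
  rcases eq_or_ne φ ∞ with rfl | ht
  · rcases eq_or_ne u 0 with rfl | hu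
    · simp
    · simp [ENNReal.mul_top, hu]
  lift φ to ℝ≥0 using ht
  have h0' : φ ≠ 0 := by simpa using h0
  rw [← ENNReal.coe_inv h0']
  norm_cast
  rw [← NNReal.coe_le_coe]
  push_cast [NNReal.sqrt_mul]
  have hφ : (0 : ℝ) < φ := by positivity
  set r := √(φ : ℝ)
  have hr : 0 < r := Real.sqrt_pos.2 hφ
  have e : (φ : ℝ) = r ^ 2 := (Real.sq_sqrt φ.2).symm
  have eu : (u : ℝ) = √(u : ℝ) ^ 2 := (Real.sq_sqrt u.2).symm
  have ev : (v : ℝ) = √(v : ℝ) ^ 2 := (Real.sq_sqrt v.2).symm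
  set a := √(u : ℝ)
  set b := √(v : ℝ)
  rw [eu, ev, e]
  have : 0 ≤ (a * r - b * r⁻¹) ^ 2 := sq_nonneg _
  have h1 : a ^ 2 * r ^ 2 + b ^ 2 * (r ^ 2)⁻¹ - 2 * (a * b) = (a * r - b * r⁻¹) ^ 2 := by
    field_simp
    ring
  linarith

/-- The equality case of AM-GM, at `φ = √(v / u)`. The value `φ = ∞` when only `u` vanishes is what
makes extended-valued test functions convenient. -/
lemma two_mul_sqrt_mul_eq (u v : ℝ≥0) :
    u * ((NNReal.sqrt v : ℝ≥0∞) / NNReal.sqrt u) + v * ((NNReal.sqrt v : ℝ≥0∞) / NNReal.sqrt u)⁻¹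
      = 2 * (NNReal.sqrt (u * v) : ℝ≥0∞) := by
  rcases eq_or_ne u 0 with rfl | hu
  · rcases eq_or_ne v 0 with rfl | hv
    · simp
    · simp [ENNReal.div_zero, hv]
  rcases eq_or_ne v 0 with rfl | hv
  · simp
  have hu' : NNReal.sqrt u ≠ 0 := by simpa using hu
  have hv' : NNReal.sqrt v ≠ 0 := by simpa using hv
  rw [← ENNReal.coe_div hu', ← ENNReal.coe_inv (div_ne_zero hv' hu')]
  norm_cast
  rw [← NNReal.coe_inj]
  push_cast [NNReal.sqrt_mul]
  have eu : (u : ℝ) = √(u : ℝ) ^ 2 := (Real.sq_sqrt u.2).symm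
  have ev : (v : ℝ) = √(v : ℝ) ^ 2 := (Real.sq_sqrt v.2).symm
  have ha : √(u : ℝ) ≠ 0 := by simpa using hu
  have hb : √(v : ℝ) ≠ 0 := by simpa using hv
  set a := √(u : ℝ)
  set b := √(v : ℝ)
  rw [eu, ev]
  field_simp
  ring

/-- The infimum is attained by the pointwise optimiser. The variational form needs no dominating
measure and gives concavity and data processing at once; this density form gives the triangle
inequality and the link to likelihood ratios. -/
lemma affinity_withDensity (ρ : Measure α) {u v : α → ℝ≥0} (hu : Measurable u)
    (hv : Measurable v) :
    affinity (ρ.withDensity fun y => u y) (ρ.withDensity fun y => v y)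
      = ∫⁻ y, 2 * (NNReal.sqrt (u y * v y) : ℝ≥0∞) ∂ρ := by
  have key : ∀ φ : α → ℝ≥0∞, Measurable φ →
      ∫⁻ y, φ y ∂(ρ.withDensity fun y => (u y : ℝ≥0∞))
        + ∫⁻ y, (φ y)⁻¹ ∂(ρ.withDensity fun y => (v y : ℝ≥0∞))
        = ∫⁻ y, (u y * φ y + v y * (φ y)⁻¹) ∂ρ := by
    intro φ hφ
    rw [lintegral_withDensity_eq_lintegral_mul _ (by fun_prop) hφ,
      lintegral_withDensity_eq_lintegral_mul _ (by fun_prop) (by fun_prop),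
      ← lintegral_add_left (by fun_prop)]
    rfl
  refine le_antisymm ?_ (le_iInf₂ fun φ hφ => ?_)
  · have hm : Measurable fun y => (NNReal.sqrt (v y) : ℝ≥0∞) / NNReal.sqrt (u y) := by fun_prop
    refine (affinity_le hm).trans ?_
    rw [key _ hm]
    exact lintegral_mono fun y => (two_mul_sqrt_mul_eq _ _).le
  · rw [key φ hφ]
    exact lintegral_mono fun y => two_mul_sqrt_mul_le _ _ _

lemma lintegral_eq_one_of_withDensity {ρ : Measure α} {u : α → ℝ≥0∞}
    (h : IsProbabilityMeasure (ρ.withDensity u)) : ∫⁻ y, u y ∂ρ = 1 := by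
  have := h.measure_univ
  rwa [withDensity_apply _ MeasurableSet.univ, Measure.restrict_univ] at this

lemma hell_withDensity (ρ : Measure α) {u v : α → ℝ≥0} (hu : Measurable u)
    (hv : Measurable v) (hpu : IsProbabilityMeasure (ρ.withDensity fun y => (u y : ℝ≥0∞)))
    (hpv : IsProbabilityMeasure (ρ.withDensity fun y => (v y : ℝ≥0∞))) :
    hell (ρ.withDensity fun y => u y) (ρ.withDensity fun y => v y)
      = ∫⁻ y, ENNReal.ofReal ((√(u y : ℝ) - √(v y : ℝ)) ^ 2) ∂ρ := by
  unfold hell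
  refine (ENNReal.eq_sub_of_add_eq
    ((affinity_le_two _ _).trans_lt ENNReal.ofNat_lt_top).ne ?_).symm
  rw [affinity_withDensity ρ hu hv, ← lintegral_add_left (by fun_prop)]
  have : ∀ y, ENNReal.ofReal ((√(u y : ℝ) - √(v y : ℝ)) ^ 2)
      + 2 * (NNReal.sqrt (u y * v y) : ℝ≥0∞) = u y + v y := by
    intro y
    have e : (2 * (NNReal.sqrt (u y * v y) : ℝ≥0∞))
        = ENNReal.ofReal (2 * (√(u y : ℝ) * √(v y : ℝ))) := by
      rw [ENNReal.ofReal_mul (by norm_num), ← Real.sqrt_mul (NNReal.coe_nonneg _), ← NNReal.coe_mul,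
        ← Real.coe_sqrt, ENNReal.ofReal_coe_nnreal]
      simp
    rw [e, ← ENNReal.ofReal_add (by positivity) (by positivity),
      ← ENNReal.ofReal_coe_nnreal, ← ENNReal.ofReal_coe_nnreal (p := v y),
      ← ENNReal.ofReal_add (NNReal.coe_nonneg _) (NNReal.coe_nonneg _)]
    congr 1
    have eu := Real.sq_sqrt (u y).2
    have ev := Real.sq_sqrt (v y).2
    simp only [NNReal.val_eq_coe] at eu ev
    nlinarith
  simp_rw [this]
  rw [lintegral_add_left (by fun_prop), lintegral_eq_one_of_withDensity hpu,
    lintegral_eq_one_of_withDensity hpv, one_add_one_eq_two]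

/-- Pointwise Young inequality for the square of `(√u - √v) + (√v - √w)`. The free weight `t` is
what later prevents exponential growth in the horizon. -/
lemma hell_triangle (ρ : Measure α) {u v w : α → ℝ≥0} (hu : Measurable u)
    (hv : Measurable v) (hw : Measurable w)
    (hpu : IsProbabilityMeasure (ρ.withDensity fun y => (u y : ℝ≥0∞)))
    (hpv : IsProbabilityMeasure (ρ.withDensity fun y => (v y : ℝ≥0∞)))
    (hpw : IsProbabilityMeasure (ρ.withDensity fun y => (w y : ℝ≥0∞)))
    {t : ℝ} (ht : 0 < t) :
    hell (ρ.withDensity fun y => u y) (ρ.withDensity fun y => w y)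
      ≤ ENNReal.ofReal (1 + t) * hell (ρ.withDensity fun y => u y) (ρ.withDensity fun y => v y)
        + ENNReal.ofReal (1 + t⁻¹)
          * hell (ρ.withDensity fun y => v y) (ρ.withDensity fun y => w y) := by
  rw [hell_withDensity ρ hu hv hpu hpv, hell_withDensity ρ hv hw hpv hpw,
    hell_withDensity ρ hu hw hpu hpw, ← lintegral_const_mul _ (by fun_prop),
    ← lintegral_const_mul _ (by fun_prop), ← lintegral_add_left (by fun_prop)]
  refine lintegral_mono fun y => ?_
  rw [← ENNReal.ofReal_mul (by positivity), ← ENNReal.ofReal_mul (by positivity),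
    ← ENNReal.ofReal_add (by positivity) (by positivity)]
  refine ENNReal.ofReal_le_ofReal ?_
  set a := √(u y : ℝ)
  set b := √(v y : ℝ)
  set c := √(w y : ℝ)
  have h : (1 + t) * (a - b) ^ 2 + (1 + t⁻¹) * (b - c) ^ 2 - (a - c) ^ 2
      = t⁻¹ * (t * (a - b) - (b - c)) ^ 2 := by
    field_simp
    ring
  have : 0 ≤ t⁻¹ * (t * (a - b) - (b - c)) ^ 2 := by positivity
  linarith

lemma exists_common_density (μ ν : Measure α) [IsFiniteMeasure μ] [IsFiniteMeasure ν] :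
    ∃ (ρ : Measure α) (u v : α → ℝ≥0), Measurable u ∧ Measurable v ∧
      μ = (ρ.withDensity fun y => (u y : ℝ≥0∞)) ∧ ν = (ρ.withDensity fun y => (v y : ℝ≥0∞)) := by
  have aux : ∀ κ : Measure α, IsFiniteMeasure κ → κ ≪ μ + ν →
      κ = (μ + ν).withDensity fun y => ((κ.rnDeriv (μ + ν) y).toNNReal : ℝ≥0∞) := by
    intro κ _ hκ
    conv_lhs => rw [← Measure.withDensity_rnDeriv_eq κ (μ + ν) hκ]
    refine withDensity_congr_ae ?_
    filter_upwards [Measure.rnDeriv_ne_top κ (μ + ν)] with y hy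
    exact (ENNReal.coe_toNNReal hy).symm
  refine ⟨μ + ν, fun y => (μ.rnDeriv (μ + ν) y).toNNReal,
    fun y => (ν.rnDeriv (μ + ν) y).toNNReal, by fun_prop, by fun_prop,
    aux μ inferInstance ?_, aux ν inferInstance ?_⟩
  · exact Measure.AbsolutelyContinuous.rfl.add_right _
  · rw [add_comm]; exact Measure.AbsolutelyContinuous.rfl.add_right _

/-- Cauchy-Schwarz applied to `g * (u - v) = (√u - √v) * (g * (√u + √v))`. -/
lemma sq_integral_sub_le_hell (μ ν : Measure α) [hμ : IsProbabilityMeasure μ]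
    [hν : IsProbabilityMeasure ν] {g : α → ℝ} (hgμ : Integrable g μ) (hgν : Integrable g ν)
    (hgμ2 : Integrable (fun y => g y ^ 2) μ) (hgν2 : Integrable (fun y => g y ^ 2) ν) :
    (∫ y, g y ∂μ - ∫ y, g y ∂ν) ^ 2
      ≤ 2 * (hell μ ν).toReal * (∫ y, g y ^ 2 ∂μ + ∫ y, g y ^ 2 ∂ν) := by
  obtain ⟨ρ, u, v, hu, hv, rfl, rfl⟩ := exists_common_density μ ν
  have hD : (hell (ρ.withDensity fun y => (u y : ℝ≥0∞))
      (ρ.withDensity fun y => (v y : ℝ≥0∞))).toReal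
      = ∫ y, (√(u y : ℝ) - √(v y : ℝ)) ^ 2 ∂ρ := by
    rw [hell_withDensity ρ hu hv hμ hν, integral_eq_lintegral_of_nonneg_ae
      (Filter.Eventually.of_forall fun y => sq_nonneg _)
      (Measurable.aestronglyMeasurable (by fun_prop))]
  rw [hD]
  have iu : Integrable (fun y => (u y : ℝ)) ρ := by
    have := (integrable_withDensity_iff_integrable_coe_smul (E := ℝ) hu).1
      (integrable_const (1 : ℝ) (μ := ρ.withDensity fun y => (u y : ℝ≥0∞)))
    simpa using this
  have iv : Integrable (fun y => (v y : ℝ)) ρ := by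
    have := (integrable_withDensity_iff_integrable_coe_smul (E := ℝ) hv).1
      (integrable_const (1 : ℝ) (μ := ρ.withDensity fun y => (v y : ℝ≥0∞)))
    simpa using this
  have i1 := (integrable_withDensity_iff_integrable_coe_smul hu).1 hgμ
  have i2 := (integrable_withDensity_iff_integrable_coe_smul hv).1 hgν
  have i3 := (integrable_withDensity_iff_integrable_coe_smul hu).1 hgμ2
  have i4 := (integrable_withDensity_iff_integrable_coe_smul hv).1 hgν2
  have iD : Integrable (fun y => (√(u y : ℝ) - √(v y : ℝ)) ^ 2) ρ := by
    refine ((iu.add iv).const_mul 2).mono' (Measurable.aestronglyMeasurable (by fun_prop))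
      (Filter.Eventually.of_forall fun y => ?_)
    have eu := Real.sq_sqrt (u y).2
    have ev := Real.sq_sqrt (v y).2
    simp only [NNReal.val_eq_coe] at eu ev
    rw [Real.norm_of_nonneg (sq_nonneg _)]
    simp only [Pi.add_apply]
    nlinarith [sq_nonneg (√(u y : ℝ) + √(v y : ℝ))]
  rw [integral_withDensity_eq_integral_smul hu, integral_withDensity_eq_integral_smul hv,
    integral_withDensity_eq_integral_smul hu, integral_withDensity_eq_integral_smul hv]
  simp only [NNReal.smul_def]
  set Du := ∫ y, (√(u y : ℝ) - √(v y : ℝ)) ^ 2 ∂ρ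
  set a := ∫ y, (u y : ℝ) • g y ∂ρ with ha
  set b := ∫ y, (v y : ℝ) • g y ∂ρ with hb
  set a2 := ∫ y, (u y : ℝ) • g y ^ 2 ∂ρ with ha2
  set b2 := ∫ y, (v y : ℝ) • g y ^ 2 ∂ρ with hb2
  -- With `p = √u` and `q = √v`, the integrand is `(s * (p - q) - g * (p + q)) ^ 2 + (g * (p - q)) ^
  -- 2`; the discriminant of this quadratic in `s` gives the bound.
  have quad : ∀ s : ℝ, 0 ≤ Du * (s * s) + (-2 * (a - b)) * s + 2 * (a2 + b2) := by
    intro s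
    have : 0 ≤ ∫ y, (s ^ 2 * (√(u y : ℝ) - √(v y : ℝ)) ^ 2
        + ((-2 * s) * ((u y : ℝ) • g y - (v y : ℝ) • g y)
          + 2 * ((u y : ℝ) • g y ^ 2 + (v y : ℝ) • g y ^ 2))) ∂ρ := by
      refine integral_nonneg fun y => ?_
      have eu := Real.sq_sqrt (u y).2
      have ev := Real.sq_sqrt (v y).2
      simp only [NNReal.val_eq_coe] at eu ev
      simp only [smul_eq_mul, Pi.zero_apply]
      set p := √(u y : ℝ)
      set q := √(v y : ℝ)
      rw [← eu, ← ev]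
      nlinarith [sq_nonneg (s * (p - q) - g y * (p + q)), sq_nonneg (g y * (p - q))]
    have j1 : Integrable (fun y => (-2 * s) * ((u y : ℝ) • g y - (v y : ℝ) • g y)) ρ :=
      (i1.sub i2).const_mul _
    have j2 : Integrable (fun y => 2 * ((u y : ℝ) • g y ^ 2 + (v y : ℝ) • g y ^ 2)) ρ :=
      (i3.add i4).const_mul 2
    have j3 : Integrable (fun y => (-2 * s) * ((u y : ℝ) • g y - (v y : ℝ) • g y)
        + 2 * ((u y : ℝ) • g y ^ 2 + (v y : ℝ) • g y ^ 2)) ρ := j1.add j2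
    rw [integral_add (iD.const_mul _) j3, integral_add j1 j2,
      integral_const_mul, integral_const_mul, integral_const_mul,
      integral_sub i1 i2, integral_add i3 i4] at this
    rw [← ha, ← hb, ← ha2, ← hb2] at this
    linarith
  have := discrim_le_zero quad
  unfold discrim at this
  nlinarith

/-- The Cauchy-Schwarz bound is used twice with the mean `m` of `ν`: on `y - m`, giving the
difference of means in terms of second moments under both laws, and on `(y - m) ^ 2`, to replace the
second moment under `μ` by the variance of `ν`. -/
lemma abs_mean_sub_le_hell (μ ν : Measure ℝ) [IsProbabilityMeasure μ] [IsProbabilityMeasure ν]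
    (hμ : ∀ᵐ y ∂μ, y ∈ Set.Icc (0 : ℝ) 1) (hν : ∀ᵐ y ∂ν, y ∈ Set.Icc (0 : ℝ) 1) :
    |∫ y, y ∂μ - ∫ y, y ∂ν|
      ≤ 3 * √(Var[id; ν] * (hell μ ν).toReal) + 2 * (hell μ ν).toReal := by
  set m := ∫ y, y ∂ν with hm
  set D := (hell μ ν).toReal
  have hD : 0 ≤ D := ENNReal.toReal_nonneg
  have hm01 : m ∈ Set.Icc (0 : ℝ) 1 := by
    have hi : Integrable (fun y : ℝ => y) ν := by
      refine (integrable_const (1 : ℝ)).mono' (by fun_prop) ?_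
      filter_upwards [hν] with y hy
      rw [Real.norm_of_nonneg hy.1]; exact hy.2
    refine ⟨integral_nonneg_of_ae (hν.mono fun y hy => hy.1), ?_⟩
    have := integral_mono_ae hi (integrable_const (1 : ℝ)) (hν.mono fun y hy => hy.2)
    simpa using this
  have bd : ∀ y ∈ Set.Icc (0 : ℝ) 1, |y - m| ≤ 1 := by
    intro y hy
    rw [abs_le]; constructor <;> linarith [hy.1, hy.2, hm01.1, hm01.2]
  have int : ∀ (κ : Measure ℝ) [IsProbabilityMeasure κ], (∀ᵐ y ∂κ, y ∈ Set.Icc (0 : ℝ) 1) →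
      ∀ k : ℕ, Integrable (fun y => (y - m) ^ k) κ := by
    intro κ _ hκ k
    refine (integrable_const (1 : ℝ)).mono' (by fun_prop) ?_
    filter_upwards [hκ] with y hy
    rw [Real.norm_eq_abs, abs_pow]
    exact pow_le_one₀ (abs_nonneg _) (bd y hy)
  set S := ∫ y, (y - m) ^ 2 ∂μ with hS
  set B := ∫ y, (y - m) ^ 2 ∂ν with hB
  have hvar : Var[id; ν] = B := by
    rw [variance_eq_integral (by fun_prop)]
    rfl
  have hS0 : 0 ≤ S := integral_nonneg fun y => sq_nonneg _
  have hB0 : 0 ≤ B := integral_nonneg fun y => sq_nonneg _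
  have four : ∀ (κ : Measure ℝ) [IsProbabilityMeasure κ], (∀ᵐ y ∂κ, y ∈ Set.Icc (0 : ℝ) 1) →
      ∫ y, ((y - m) ^ 2) ^ 2 ∂κ ≤ ∫ y, (y - m) ^ 2 ∂κ := by
    intro κ _ hκ
    refine integral_mono_ae (by simpa only [← pow_mul] using int κ hκ 4) (int κ hκ 2) ?_
    filter_upwards [hκ] with y hy
    have h1 : (y - m) ^ 2 ≤ 1 := by
      rw [← sq_abs]; exact pow_le_one₀ (abs_nonneg _) (bd y hy)
    exact pow_le_of_le_one (sq_nonneg _) h1 two_ne_zero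
  have second : (S - B) ^ 2 ≤ 2 * D * (S + B) := by
    refine (sq_integral_sub_le_hell μ ν (int μ hμ 2) (int ν hν 2)
      (by simpa only [← pow_mul] using int μ hμ 4)
      (by simpa only [← pow_mul] using int ν hν 4)).trans ?_
    gcongr
    · exact four μ hμ
    · exact four ν hν
  -- From `second`, `S - B ≤ √(2 * D * (S + B)) ≤ D + (S + B) / 2`.
  have hSB : S ≤ 3 * B + 2 * D := by
    nlinarith [sq_nonneg (S + B - 2 * D), sq_nonneg (S - B - D - (S + B) / 2)]
  have first : (∫ y, y ∂μ - m) ^ 2 ≤ 2 * D * (S + B) := by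
    have := sq_integral_sub_le_hell μ ν (g := fun y => y - m)
      (by simpa using int μ hμ 1) (by simpa using int ν hν 1) (int μ hμ 2) (int ν hν 2)
    have hi : ∀ (κ : Measure ℝ) [IsProbabilityMeasure κ], (∀ᵐ y ∂κ, y ∈ Set.Icc (0 : ℝ) 1) →
        ∫ y, (y - m) ∂κ = ∫ y, y ∂κ - m := by
      intro κ _ hκ
      have h1 : Integrable (fun y : ℝ => y) κ := by
        refine ((int κ hκ 1).add (integrable_const m)).congr (Filter.Eventually.of_forall ?_)
        intro y
        simp
      rw [integral_sub h1 (integrable_const _)]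
      simp
    rw [hi μ hμ, hi ν hν] at this
    convert this using 2
    ring
  rw [hvar]
  refine abs_le_of_sq_le_sq ?_ (by positivity)
  have hs : √(B * D) ^ 2 = B * D := Real.sq_sqrt (by positivity)
  have hs0 : 0 ≤ √(B * D) := Real.sqrt_nonneg _
  nlinarith [mul_nonneg hs0 hD, mul_nonneg hB0 hD]

end Hellinger

attribute [instance] CondDist.isMarkov Policy.isMarkov MDP.init_isProbability MDP.trans_isMarkov
  MDP.cost_isMarkov

/-! ### Mixtures: concavity of the affinity. -/

section Mixture

variable {α β : Type*} [MeasurableSpace α] [MeasurableSpace β]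

/-- One test function `φ` serves the mixture, while each component may choose its own, so the
averaged infimum is no larger. -/
lemma lintegral_affinity_le (m : Measure β) (κ η : Kernel β α) :
    ∫⁻ b, affinity (κ b) (η b) ∂m ≤ affinity (m.bind κ) (m.bind η) := by
  refine le_iInf₂ fun φ hφ => ?_
  have hφ' : Measurable fun y => (φ y)⁻¹ := hφ.inv
  rw [Measure.lintegral_bind κ.aemeasurable hφ.aemeasurable,
    Measure.lintegral_bind η.aemeasurable hφ'.aemeasurable,
    ← lintegral_add_left hφ.lintegral_kernel]
  exact lintegral_mono fun b => affinity_le hφ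

lemma hell_bind_le (m : Measure β) [IsProbabilityMeasure m] (κ η : Kernel β α)
    (h : Measurable fun b => affinity (κ b) (η b)) :
    hell (m.bind κ) (m.bind η) ≤ ∫⁻ b, hell (κ b) (η b) ∂m := by
  refine le_trans ?_ (lintegral_sub_le' _ _ h.aemeasurable)
  rw [lintegral_const, measure_univ, mul_one]
  exact tsub_le_tsub_left (lintegral_affinity_le m κ η) 2

end Mixture

/-! ### Conditional distributions and the Bellman backup. -/

variable {H N : ℕ} {X A : Type*} [MeasurableSpace X] [MeasurableSpace A] {ρ : Measure ℝ}

lemma CondDist.measurable_density_apply (f : CondDist X A ρ) (p : X × A) :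
    Measurable (f.density p) :=
  f.measurable_density.comp measurable_prodMk_left

lemma CondDist.isProbabilityMeasure_withDensity (f : CondDist X A ρ) (p : X × A) :
    IsProbabilityMeasure (ρ.withDensity fun y => (f.density p y : ℝ≥0∞)) := by
  rw [← f.kernel_eq p]; infer_instance

lemma CondDist.lintegral_kernel (f : CondDist X A ρ) (p : X × A) {φ : ℝ → ℝ≥0∞}
    (hφ : Measurable φ) : ∫⁻ y, φ y ∂(f.kernel p) = ∫⁻ y, f.density p y * φ y ∂ρ := by
  have := f.measurable_density_apply p
  rw [f.kernel_eq, lintegral_withDensity_eq_lintegral_mul _ (by fun_prop) hφ]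
  rfl

/-- Integrating against `g.kernel` instead of `ρ`, which need not be σ-finite, makes the affinity
measurable in `p`; it also exhibits the affinity as twice the mean square root of a likelihood
ratio. Points where the density of `g` vanishes contribute zero on both sides. -/
lemma affinity_kernel (f g : CondDist X A ρ) (p : X × A) :
    affinity (f.kernel p) (g.kernel p)
      = 2 * ∫⁻ y, (NNReal.sqrt (f.density p y / g.density p y) : ℝ≥0∞) ∂(g.kernel p) := by
  have hf := f.measurable_density_apply p
  have hg := g.measurable_density_apply p
  rw [g.lintegral_kernel p (by fun_prop), f.kernel_eq, g.kernel_eq, affinity_withDensity ρ hf hg,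
    ← lintegral_const_mul _ (by fun_prop)]
  refine lintegral_congr fun y => ?_
  congr 1
  norm_cast
  set u := f.density p y
  set v := g.density p y
  rcases eq_or_ne v 0 with hv | hv
  · simp [hv]
  · rw [NNReal.sqrt_eq_iff_eq_sq, mul_pow, NNReal.sq_sqrt]
    field_simp

lemma measurable_affinity (f g : CondDist X A ρ) :
    Measurable fun p => affinity (f.kernel p) (g.kernel p) := by
  simp_rw [affinity_kernel]
  refine Measurable.const_mul ?_ _
  have hf := f.measurable_density
  have hg := g.measurable_density
  refine Measurable.lintegral_kernel_prod_right (κ := g.kernel)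
    (f := fun p y => (NNReal.sqrt (f.density p y / g.density p y) : ℝ≥0∞)) ?_
  simp only [Function.uncurry_def] at hf hg ⊢
  fun_prop

lemma measurable_hell (f g : CondDist X A ρ) :
    Measurable fun p => hell (f.kernel p) (g.kernel p) :=
  measurable_const.sub (measurable_affinity f g)

lemma CondDist.hell_triangle (f g k : CondDist X A ρ) (p : X × A) {t : ℝ} (ht : 0 < t) :
    hell (f.kernel p) (k.kernel p) ≤ ENNReal.ofReal (1 + t) * hell (f.kernel p) (g.kernel p)
      + ENNReal.ofReal (1 + t⁻¹) * hell (g.kernel p) (k.kernel p) := by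
  rw [f.kernel_eq, g.kernel_eq, k.kernel_eq]
  exact OfflineDistRL.hell_triangle ρ (f.measurable_density_apply p)
    (g.measurable_density_apply p) (k.measurable_density_apply p)
    (f.isProbabilityMeasure_withDensity p) (g.isProbabilityMeasure_withDensity p)
    (k.isProbabilityMeasure_withDensity p) ht

instance isMarkovKernel_follow (π : Kernel X A) (d : Kernel (X × A) ℝ) [IsMarkovKernel π]
    [IsMarkovKernel d] : IsMarkovKernel (follow π d) := by
  unfold follow; infer_instance

instance isMarkovKernel_terminal : IsMarkovKernel (terminal : Kernel X ℝ) := by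
  unfold terminal; infer_instance

/-- The law of the return collected from step `n` on, according to the candidate `f`. -/
def tail (π : Policy H X A) (f : Fin H → CondDist X A ρ) (n : ℕ) : Kernel X ℝ :=
  if hn : n < H then follow (π.act ⟨n, hn⟩) (f ⟨n, hn⟩).kernel else terminal

lemma continuation_eq_tail (π : Policy H X A) (f : Fin H → CondDist X A ρ) (h : Fin H) :
    continuation π f h = tail π f (h + 1) := rfl

instance isMarkovKernel_tail (π : Policy H X A) (f : Fin H → CondDist X A ρ) (n : ℕ) :
    IsMarkovKernel (tail π f n) := by
  unfold tail; split <;> infer_instance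

instance isMarkovKernel_continuation (π : Policy H X A) (f : Fin H → CondDist X A ρ)
    (h : Fin H) : IsMarkovKernel (continuation π f h) := by
  rw [continuation_eq_tail]; infer_instance

lemma lintegral_follow (π : Kernel X A) (d : Kernel (X × A) ℝ) [IsMarkovKernel π] (x : X)
    {φ : ℝ → ℝ≥0∞} (hφ : Measurable φ) :
    ∫⁻ y, φ y ∂(follow π d x) = ∫⁻ a, ∫⁻ y, φ y ∂(d (x, a)) ∂(π x) := by
  unfold follow
  rw [Kernel.lintegral_comp _ _ _ hφ, Kernel.lintegral_id_prod hφ.lintegral_kernel]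

lemma lintegral_bellman (M : MDP H X A) (h : Fin H) (κ : Kernel X ℝ) [IsMarkovKernel κ]
    (p : X × A) {φ : ℝ → ℝ≥0∞} (hφ : Measurable φ) :
    ∫⁻ y, φ y ∂(bellman M h κ p)
      = ∫⁻ c, ∫⁻ y, φ (c + y) ∂((κ ∘ₖ M.trans h) p) ∂(M.cost h p) := by
  unfold bellman
  rw [Kernel.lintegral_map _ (by fun_prop) _ hφ, Kernel.lintegral_prod _ _ _ (by fun_prop)]

/-- Data processing: adding an independent cost cannot increase the distance, since for each value
`c` of it the shifted `φ (c + ·)` is a valid test function. -/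
lemma hell_bellman_le (M : MDP H X A) (h : Fin H) (κ η : Kernel X ℝ) [IsMarkovKernel κ]
    [IsMarkovKernel η] (p : X × A) :
    hell (bellman M h κ p) (bellman M h η p)
      ≤ hell ((κ ∘ₖ M.trans h) p) ((η ∘ₖ M.trans h) p) := by
  refine tsub_le_tsub_left (le_iInf₂ fun φ hφ => ?_) 2
  have hφ' : Measurable fun y => (φ y)⁻¹ := hφ.inv
  rw [lintegral_bellman M h κ p hφ, lintegral_bellman M h η p hφ',
    ← lintegral_add_left (by
      refine Measurable.lintegral_prod_right (f := fun c y => φ (c + y)) ?_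
      simp only [Function.uncurry_def]; fun_prop)]
  calc affinity ((κ ∘ₖ M.trans h) p) ((η ∘ₖ M.trans h) p)
      = ∫⁻ _, affinity ((κ ∘ₖ M.trans h) p) ((η ∘ₖ M.trans h) p) ∂(M.cost h p) := by simp
    _ ≤ _ := lintegral_mono fun c => affinity_le (φ := fun y => φ (c + y)) (by fun_prop)

/-- One step of the state-action chain: `x' ∼ P_h(x,a)` and then `a' ∼ π(x')`. -/
def transAct (M : MDP H X A) (h : Fin H) (π : Kernel X A) : Kernel (X × A) (X × A) :=
  (Kernel.id ×ₖ π) ∘ₖ M.trans h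

instance isMarkovKernel_transAct (M : MDP H X A) (h : Fin H) (π : Kernel X A)
    [IsMarkovKernel π] : IsMarkovKernel (transAct M h π) := by
  unfold transAct; infer_instance

lemma lintegral_transAct (M : MDP H X A) (h : Fin H) (π : Kernel X A) [IsMarkovKernel π]
    (p : X × A) {g : X × A → ℝ≥0∞} (hg : Measurable g) :
    ∫⁻ q, g q ∂(transAct M h π p) = ∫⁻ x, ∫⁻ a, g (x, a) ∂(π x) ∂(M.trans h p) := by
  unfold transAct
  rw [Kernel.lintegral_comp _ _ _ hg]
  simp_rw [Kernel.lintegral_id_prod hg]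

/-- Non-expansiveness of the backup: drop the cost, then use convexity over the next state-action
pair. -/
lemma hell_bellman_follow_le (M : MDP H X A) (h : Fin H) (π : Kernel X A) [IsMarkovKernel π]
    (f g : CondDist X A ρ) (p : X × A) :
    hell (bellman M h (follow π f.kernel) p) (bellman M h (follow π g.kernel) p)
      ≤ ∫⁻ q, hell (f.kernel q) (g.kernel q) ∂(transAct M h π p) := by
  refine (hell_bellman_le M h _ _ p).trans ?_
  have e : ∀ d : Kernel (X × A) ℝ,
      (follow π d ∘ₖ M.trans h) p = (transAct M h π p).bind d := by
    intro d
    rw [follow, Kernel.comp_assoc, ← transAct, Kernel.comp_apply]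
  rw [e, e]
  exact hell_bind_le _ _ _ (measurable_affinity f g)

/-! ### Roll-ins and occupancy measures. -/

instance isProbabilityMeasure_rollIn (M : MDP H X A) (π : Policy H X A) (n : ℕ) :
    IsProbabilityMeasure (rollIn M π n) := by
  induction n with
  | zero => unfold rollIn; infer_instance
  | succ n ih =>
    unfold rollIn
    split
    · exact Measure.isProbabilityMeasure_map (by fun_prop)
    · exact ih

instance isProbabilityMeasure_occupancy (M : MDP H X A) (π : Policy H X A) (h : Fin H) :
    IsProbabilityMeasure (occupancy M π h) := by
  have : IsProbabilityMeasure ((rollIn M π h).map Prod.fst) :=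
    Measure.isProbabilityMeasure_map (by fun_prop)
  unfold occupancy
  infer_instance

lemma lintegral_rollIn_succ (M : MDP H X A) (π : Policy H X A) {n : ℕ} (hn : n < H)
    {g : X × ℝ → ℝ≥0∞} (hg : Measurable g) :
    ∫⁻ q, g q ∂(rollIn M π (n + 1))
      = ∫⁻ q, ∫⁻ a, ∫⁻ c, ∫⁻ x, g (x, q.2 + c) ∂(M.trans ⟨n, hn⟩ (q.1, a))
          ∂(M.cost ⟨n, hn⟩ (q.1, a)) ∂(π.act ⟨n, hn⟩ q.1) ∂(rollIn M π n) := by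
  conv_lhs => unfold rollIn
  rw [dif_pos hn, lintegral_map hg (by fun_prop), Measure.lintegral_compProd (by fun_prop),
    Measure.lintegral_compProd (by
      refine Measurable.lintegral_kernel_prod_right
        (f := fun (a : (X × ℝ) × A) (b : ℝ × X) => g (b.2, a.1.2 + b.1)) ?_
      simp only [Function.uncurry_def]; fun_prop)]
  refine lintegral_congr fun q => ?_
  rw [Kernel.comap_apply]
  refine lintegral_congr fun a => ?_
  rw [Kernel.comap_apply, Kernel.lintegral_prod _ _ _ (by fun_prop)]

lemma lintegral_occupancy (M : MDP H X A) (π : Policy H X A) (h : Fin H)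
    {g : X × A → ℝ≥0∞} (hg : Measurable g) :
    ∫⁻ p, g p ∂(occupancy M π h)
      = ∫⁻ q, ∫⁻ a, g (q.1, a) ∂(π.act h q.1) ∂(rollIn M π h) := by
  have : IsProbabilityMeasure ((rollIn M π h).map Prod.fst) :=
    Measure.isProbabilityMeasure_map (by fun_prop)
  unfold occupancy
  rw [Measure.lintegral_compProd hg, lintegral_map ?_ measurable_fst]
  exact Measurable.lintegral_kernel_prod_right' hg

lemma lintegral_occupancy_succ (M : MDP H X A) (π : Policy H X A) (h : Fin H)
    (hh : (h : ℕ) + 1 < H) {g : X × A → ℝ≥0∞} (hg : Measurable g) :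
    ∫⁻ p, g p ∂(occupancy M π ⟨h + 1, hh⟩)
      = ∫⁻ p, ∫⁻ q, g q ∂(transAct M h (π.act ⟨h + 1, hh⟩) p) ∂(occupancy M π h) := by
  rw [lintegral_occupancy M π _ hg, lintegral_occupancy M π h hg.lintegral_kernel,
    lintegral_rollIn_succ M π h.2 (by
      have : Measurable fun x => ∫⁻ a, g (x, a) ∂(π.act ⟨h + 1, hh⟩ x) :=
        Measurable.lintegral_kernel_prod_right' hg
      exact this.comp measurable_fst)]
  refine lintegral_congr fun q => lintegral_congr fun a => ?_
  rw [lintegral_transAct _ _ _ _ hg]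
  simp

/-! ### Bellman fixed points and the law of the return. -/

lemma measurable_lintegral_tail (π : Policy H X A) (f : Fin H → CondDist X A ρ) (n : ℕ)
    {φ : ℝ → ℝ≥0∞} (hφ : Measurable φ) :
    Measurable fun q : X × ℝ => ∫⁻ y, φ (q.2 + y) ∂(tail π f n q.1) := by
  have := Measurable.lintegral_kernel_prod_right'
    (κ := (tail π f n).comap (Prod.fst : X × ℝ → X) measurable_fst)
    (f := fun q : (X × ℝ) × ℝ => φ (q.1.2 + q.2)) (by fun_prop)
  simpa only [Kernel.comap_apply] using this

/-- A fixed point of the distributional Bellman operator of `π`. -/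
def IsBellmanFixed (M : MDP H X A) (π : Policy H X A) (f : Fin H → CondDist X A ρ) : Prop :=
  ∀ h, (f h).kernel = bellman M h (continuation π f h)

/-- For a fixed point, the law of the cost accumulated over `n` steps plus a predicted tail does not
depend on `n`. At `n = H` the tail is zero; at `n = 0` everything is prediction. -/
lemma lintegral_returnLaw (M : MDP H X A) (π : Policy H X A) {f : Fin H → CondDist X A ρ}
    (hf : IsBellmanFixed M π f) {φ : ℝ → ℝ≥0∞} (hφ : Measurable φ) {n : ℕ} (hn : n ≤ H) :
    ∫⁻ q, ∫⁻ y, φ (q.2 + y) ∂(tail π f n q.1) ∂(rollIn M π n)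
      = ∫⁻ z, φ z ∂(returnLaw M π) := by
  induction hn using Nat.decreasingInduction with
  | self =>
    unfold returnLaw
    rw [lintegral_map hφ measurable_snd]
    refine lintegral_congr fun q => ?_
    unfold tail terminal
    rw [dif_neg (lt_irrefl H), Kernel.const_apply, lintegral_dirac' _ (by fun_prop), add_zero]
  | of_succ n hn ih =>
    rw [← ih, lintegral_rollIn_succ M π hn (measurable_lintegral_tail π f (n + 1) hφ)]
    refine lintegral_congr fun q => ?_
    conv_lhs => unfold tail
    rw [dif_pos hn, lintegral_follow _ _ _ (by fun_prop)]
    refine lintegral_congr fun a => ?_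
    rw [hf, lintegral_bellman _ _ _ _ (by fun_prop)]
    refine lintegral_congr fun c => ?_
    rw [Kernel.lintegral_comp _ _ _ (by fun_prop)]
    simp only [continuation_eq_tail, add_assoc]

/-- The law of the return predicted by the first component of `f`. -/
def predictedLaw [NeZero H] (M : MDP H X A) (π : Policy H X A) (f : Fin H → CondDist X A ρ) :
    Measure ℝ :=
  (occupancy M π 0).bind (f 0).kernel

lemma returnLaw_eq_predictedLaw [NeZero H] (M : MDP H X A) (π : Policy H X A)
    {f : Fin H → CondDist X A ρ} (hf : IsBellmanFixed M π f) :
    returnLaw M π = predictedLaw M π f := by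
  refine Measure.ext_of_lintegral _ fun φ hφ => ?_
  rw [← lintegral_returnLaw M π hf hφ (Nat.zero_le H)]
  unfold predictedLaw
  rw [Measure.lintegral_bind (f 0).kernel.aemeasurable hφ.aemeasurable,
    lintegral_occupancy _ _ _ hφ.lintegral_kernel]
  rw [show (((0 : Fin H) : ℕ)) = 0 from Fin.val_zero H]
  unfold rollIn
  rw [lintegral_prod _ (measurable_lintegral_tail π f 0 hφ).aemeasurable,
    lintegral_prod _ (by
      have : Measurable fun x => ∫⁻ a, ∫⁻ y, φ y ∂((f 0).kernel (x, a)) ∂(π.act 0 x) :=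
        Measurable.lintegral_kernel_prod_right' hφ.lintegral_kernel
      exact (this.comp measurable_fst).aemeasurable)]
  refine lintegral_congr fun x => ?_
  have hm : Measurable fun s : ℝ => ∫⁻ y, φ (s + y) ∂(tail π f 0 x) :=
    (measurable_lintegral_tail π f 0 hφ).comp measurable_prodMk_left
  dsimp only
  rw [lintegral_dirac' _ hm]
  simp only [zero_add, lintegral_const, measure_univ, mul_one]
  unfold tail
  rw [dif_pos (NeZero.pos H), lintegral_follow _ _ _ hφ]
  rfl

instance isProbabilityMeasure_predictedLaw [NeZero H] (M : MDP H X A) (π : Policy H X A)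
    (f : Fin H → CondDist X A ρ) : IsProbabilityMeasure (predictedLaw M π f) := by
  unfold predictedLaw; infer_instance

lemma predictedLaw_mem_unit [NeZero H] (M : MDP H X A) (π : Policy H X A)
    (f : Fin H → CondDist X A ρ) : ∀ᵐ y ∂(predictedLaw M π f), y ∈ Set.Icc (0 : ℝ) 1 :=
  Measure.ae_comp_of_ae_ae measurableSet_Icc (Filter.Eventually.of_forall (f 0).mem_unit)

lemma estimate_eq [NeZero H] (M : MDP H X A) (π : Policy H X A) (f : Fin H → CondDist X A ρ) :
    estimate M π f = ∫ y, y ∂(predictedLaw M π f) := by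
  have h0 : (rollIn M π ((0 : Fin H) : ℕ)).map Prod.fst = M.init := by
    rw [show (((0 : Fin H) : ℕ)) = 0 from Fin.val_zero H]
    unfold rollIn
    rw [Measure.map_fst_prod]
    simp
  have hi : Integrable (fun y : ℝ => y) (predictedLaw M π f) := by
    refine (integrable_const (1 : ℝ)).mono' (by fun_prop) ?_
    filter_upwards [predictedLaw_mem_unit M π f] with y hy
    rw [Real.norm_of_nonneg hy.1]; exact hy.2
  unfold predictedLaw at hi ⊢
  rw [Measure.comp_eq_comp_const_apply] at hi
  have h1 : Integrable (fun p => ∫ y, y ∂((f 0).kernel p)) (occupancy M π 0) := by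
    simpa using hi.integral_comp
  rw [Measure.comp_eq_comp_const_apply, Kernel.integral_comp hi, Kernel.const_apply]
  unfold occupancy at h1 ⊢
  rw [h0] at h1 ⊢
  rw [Measure.integral_compProd h1]
  rfl

lemma tail_congr (π : Policy H X A) {f g : Fin H → CondDist X A ρ} {n : ℕ}
    (h : ∀ hn : n < H, f ⟨n, hn⟩ = g ⟨n, hn⟩) : tail π f n = tail π g n := by
  unfold tail
  split
  · rename_i hn
    rw [h hn]
  · rfl

lemma BellmanComplete.exists_backup {M : MDP H X A} {Pi : Finset (Policy H X A)}
    {F : Fin H → Finset (CondDist X A ρ)} (hF : BellmanComplete M Pi F) {π : Policy H X A}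
    (hπ : π ∈ Pi) {f : Fin H → CondDist X A ρ} {h : Fin H}
    (hf : ∀ hh : (h : ℕ) + 1 < H, f ⟨h + 1, hh⟩ ∈ F ⟨h + 1, hh⟩) :
    ∃ g ∈ F h, g.kernel = bellman M h (continuation π f h) := by
  by_cases hh : (h : ℕ) + 1 < H
  · obtain ⟨g, hg, e⟩ := hF.step π hπ h hh _ (hf hh)
    refine ⟨g, hg, ?_⟩
    rw [e, continuation, dif_pos hh]
  · obtain ⟨g, hg, e⟩ := hF.last h (by omega)
    refine ⟨g, hg, ?_⟩
    rw [e, continuation, dif_neg hh]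

/-- Backward construction by repeated backups, each staying in the class by completeness. Only
equality of kernels is available, so densities are whichever versions the class provides. -/
lemma BellmanComplete.exists_fixed [NeZero H] {M : MDP H X A} {Pi : Finset (Policy H X A)}
    {F : Fin H → Finset (CondDist X A ρ)} (hF : BellmanComplete M Pi F) {π : Policy H X A}
    (hπ : π ∈ Pi) : ∃ f ∈ Fintype.piFinset F, IsBellmanFixed M π f := by
  classical
  have hH : 0 < H := NeZero.pos H
  have key : ∀ n, n ≤ H → ∃ f : Fin H → CondDist X A ρ, ∀ h : Fin H, n ≤ h →
      f h ∈ F h ∧ (f h).kernel = bellman M h (continuation π f h) := by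
    intro n hn
    induction hn using Nat.decreasingInduction with
    | self =>
      -- No step satisfies `H ≤ h`; `g` only serves as a default value.
      obtain ⟨g, -, -⟩ := hF.last ⟨H - 1, by omega⟩ (by simp only; omega)
      exact ⟨fun _ => g, fun h hh => absurd h.2 (by omega)⟩
    | of_succ n hn ih =>
      obtain ⟨f, hf⟩ := ih
      obtain ⟨g, hg, e⟩ := hF.exists_backup hπ (f := f) (h := ⟨n, hn⟩)
        (fun hh => (hf ⟨n + 1, hh⟩ le_rfl).1)
      -- Changing component `n` cannot affect the continuations at steps `h ≥ n`, which read
      -- component `h + 1`.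
      have hc : ∀ h : Fin H, n ≤ h →
          continuation π (Function.update f ⟨n, hn⟩ g) h = continuation π f h := by
        intro h hh
        rw [continuation_eq_tail, continuation_eq_tail]
        refine tail_congr π fun h' => Function.update_of_ne ?_ _ _
        simp only [ne_eq, Fin.mk.injEq]
        omega
      refine ⟨Function.update f ⟨n, hn⟩ g, fun h hh => ?_⟩
      rw [hc h hh]
      by_cases hne : h = ⟨n, hn⟩
      · subst hne
        rw [Function.update_self]
        exact ⟨hg, e⟩
      · rw [Function.update_of_ne hne]
        refine hf h ?_
        have : (h : ℕ) ≠ n := fun h' => hne (Fin.ext h')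
        omega
  obtain ⟨f, hf⟩ := key 0 (Nat.zero_le H)
  exact ⟨f, Fintype.mem_piFinset.2 fun h => (hf h (Nat.zero_le _)).1,
    fun h => (hf h (Nat.zero_le _)).2⟩

/-! ### Propagation of Bellman errors. -/

/-- Split the distance from `f` to `Z` at the backup `g`: the first leg is the Bellman error, the
second is at most the next step's distance, by non-expansiveness. Here `k` counts the steps after
`h`. -/
lemma lintegral_hell_fixed_le (M : MDP H X A) (π : Policy H X A)
    {f g Z : Fin H → CondDist X A ρ} (hZ : IsBellmanFixed M π Z)
    (hg : ∀ h, (g h).kernel = bellman M h (continuation π f h)) {ε : ℝ≥0∞}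
    (hε : ∀ h, ∫⁻ p, hell ((f h).kernel p) ((g h).kernel p) ∂(occupancy M π h) ≤ ε)
    (k : ℕ) (h : Fin H) (hk : (h : ℕ) + (k + 1) = H) :
    ∫⁻ p, hell ((f h).kernel p) ((Z h).kernel p) ∂(occupancy M π h)
      ≤ ENNReal.ofReal (((k : ℝ) + 1) ^ 2) * ε := by
  induction k generalizing h with
  | zero =>
    have : (Z h).kernel = (g h).kernel := by
      rw [hZ, hg, continuation_eq_tail, continuation_eq_tail]
      congr 1
      exact tail_congr π fun h' => absurd h' (by omega)
    rw [this]
    simpa using hε h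
  | succ k ih =>
    have hh : (h : ℕ) + 1 < H := by omega
    have hstep : ∫⁻ p, hell ((g h).kernel p) ((Z h).kernel p) ∂(occupancy M π h)
        ≤ ENNReal.ofReal (((k : ℝ) + 1) ^ 2) * ε := by
      refine le_trans ?_ (ih ⟨h + 1, hh⟩ (by simp only; omega))
      rw [lintegral_occupancy_succ M π h hh (measurable_hell _ _), hg, hZ]
      refine lintegral_mono fun p => ?_
      have e : ∀ f : Fin H → CondDist X A ρ,
          continuation π f h = follow (π.act ⟨h + 1, hh⟩) (f ⟨h + 1, hh⟩).kernel := by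
        intro f
        rw [continuation, dif_pos hh]
      rw [e, e]
      exact hell_bellman_follow_le _ _ _ _ _ _
    -- The weight `t = k + 1` closes the recursion: `(1 + t) + (1 + t⁻¹) * t ^ 2 = (t + 1) ^ 2`.
    have ht : (0 : ℝ) < (k : ℝ) + 1 := by positivity
    calc ∫⁻ p, hell ((f h).kernel p) ((Z h).kernel p) ∂(occupancy M π h)
        ≤ ∫⁻ p, (ENNReal.ofReal (1 + ((k : ℝ) + 1)) * hell ((f h).kernel p) ((g h).kernel p)
          + ENNReal.ofReal (1 + ((k : ℝ) + 1)⁻¹) * hell ((g h).kernel p) ((Z h).kernel p))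
            ∂(occupancy M π h) :=
          lintegral_mono fun p => CondDist.hell_triangle _ _ _ p ht
      _ = ENNReal.ofReal (1 + ((k : ℝ) + 1))
            * ∫⁻ p, hell ((f h).kernel p) ((g h).kernel p) ∂(occupancy M π h)
          + ENNReal.ofReal (1 + ((k : ℝ) + 1)⁻¹)
            * ∫⁻ p, hell ((g h).kernel p) ((Z h).kernel p) ∂(occupancy M π h) := by
          rw [lintegral_add_left ((measurable_hell _ _).const_mul _),
            lintegral_const_mul _ (measurable_hell _ _),
            lintegral_const_mul _ (measurable_hell _ _)]
      _ ≤ ENNReal.ofReal (1 + ((k : ℝ) + 1)) * ε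
          + ENNReal.ofReal (1 + ((k : ℝ) + 1)⁻¹) * (ENNReal.ofReal (((k : ℝ) + 1) ^ 2) * ε) := by
          gcongr
          exact hε h
      _ = ENNReal.ofReal (((k + 1 : ℕ) + 1 : ℝ) ^ 2) * ε := by
          rw [← mul_assoc, ← ENNReal.ofReal_mul (by positivity), ← add_mul,
            ← ENNReal.ofReal_add (by positivity) (by positivity)]
          congr 2
          push_cast
          field_simp
          ring

lemma lintegral_occupancy_le (M : MDP H X A) (ν : Fin H → Measure (X × A))
    (hν : ∀ h, IsProbabilityMeasure (ν h)) (π : Policy H X A)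
    (hC : concentrability M ν π ≠ ∞) (h : Fin H) {g : X × A → ℝ≥0∞} (hg : Measurable g) :
    ∫⁻ p, g p ∂(occupancy M π h) ≤ concentrability M ν π * ∫⁻ p, g p ∂(ν h) := by
  classical
  have hle := le_iSup (fun h => if occupancy M π h ≪ ν h then
    essSup ((occupancy M π h).rnDeriv (ν h)) (ν h) else ∞) h
  by_cases hac : occupancy M π h ≪ ν h
  · have hle' : essSup ((occupancy M π h).rnDeriv (ν h)) (ν h) ≤ concentrability M ν π := by
      simpa only [concentrability, hac, if_true] using hle
    rw [← lintegral_rnDeriv_mul hac hg.aemeasurable, ← lintegral_const_mul _ hg]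
    refine lintegral_mono_ae ?_
    filter_upwards [ENNReal.ae_le_essSup ((occupancy M π h).rnDeriv (ν h))] with p hp
    gcongr
    exact hp.trans hle'
  · refine absurd ?_ hC
    simpa only [concentrability, hac, if_false, top_le_iff] using hle

/-- The value estimate of a candidate with small Bellman error under `ν` exceeds the value by at
most a variance-dependent amount. -/
lemma estimate_sub_value_le [NeZero H] (M : MDP H X A) (ν : Fin H → Measure (X × A))
    (hν : ∀ h, IsProbabilityMeasure (ν h)) (π : Policy H X A)
    (hC : concentrability M ν π ≠ ∞) {f g Z : Fin H → CondDist X A ρ}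
    (hZ : IsBellmanFixed M π Z) (hg : ∀ h, (g h).kernel = bellman M h (continuation π f h))
    {ε : ℝ} (hε0 : 0 ≤ ε)
    (hε : ∀ h, ∫⁻ p, hell ((f h).kernel p) ((g h).kernel p) ∂(ν h) ≤ ENNReal.ofReal ε) :
    estimate M π f - value M π
      ≤ 3 * √(returnVar M π * (H ^ 2 * (concentrability M ν π).toReal * ε))
        + 2 * (H ^ 2 * (concentrability M ν π).toReal * ε) := by
  set C := concentrability M ν π
  have hocc : ∀ h, ∫⁻ p, hell ((f h).kernel p) ((g h).kernel p) ∂(occupancy M π h)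
      ≤ C * ENNReal.ofReal ε := fun h =>
    (lintegral_occupancy_le M ν hν π hC h (measurable_hell _ _)).trans (by gcongr; exact hε h)
  have hH : 0 < H := NeZero.pos H
  have h1 := lintegral_hell_fixed_le M π hZ hg hocc (H - 1) 0 (by simp only [Fin.val_zero]; omega)
  have hcast : ((H - 1 : ℕ) : ℝ) + 1 = H := by
    rw [Nat.cast_sub hH]; simp
  rw [hcast] at h1
  have h2 : hell (predictedLaw M π f) (predictedLaw M π Z)
      ≤ ENNReal.ofReal (H ^ 2 * C.toReal * ε) := by
    refine (hell_bind_le _ _ _ (measurable_affinity _ _)).trans (h1.trans ?_)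
    rw [mul_assoc, ENNReal.ofReal_mul (by positivity), ENNReal.ofReal_mul (by positivity),
      ENNReal.ofReal_toReal hC]
  have h3 : (hell (predictedLaw M π f) (predictedLaw M π Z)).toReal ≤ H ^ 2 * C.toReal * ε :=
    ENNReal.toReal_le_of_le_ofReal (by positivity) h2
  have h4 := abs_mean_sub_le_hell (predictedLaw M π f) (predictedLaw M π Z)
    (predictedLaw_mem_unit M π f) (predictedLaw_mem_unit M π Z)
  rw [← estimate_eq, ← returnLaw_eq_predictedLaw M π hZ] at h4
  rw [← returnLaw_eq_predictedLaw M π hZ] at h3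
  have hvar : 0 ≤ returnVar M π := variance_nonneg _ _
  refine (le_abs_self _).trans (h4.trans ?_)
  unfold returnVar at hvar ⊢
  gcongr

lemma estimate_fixed [NeZero H] (M : MDP H X A) (π : Policy H X A) {Z : Fin H → CondDist X A ρ}
    (hZ : IsBellmanFixed M π Z) : estimate M π Z = value M π := by
  rw [estimate_eq, ← returnLaw_eq_predictedLaw M π hZ, value]

/-! ### Likelihood ratio tests. -/

/-- The likelihood `∏_i g(z_i ∣ x_{h,i}, a_{h,i})`. -/
def lik (D : Dataset H N X A ρ) (π : Policy H X A) (f : Fin H → CondDist X A ρ) (h : Fin H)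
    (g : CondDist X A ρ) : ℝ≥0 :=
  ∏ i, g.density (D.xa h i) (D.c h i + D.y π f h i)

lemma logLik_eq (D : Dataset H N X A ρ) (π : Policy H X A) (f : Fin H → CondDist X A ρ)
    (h : Fin H) (g : CondDist X A ρ) : logLik D π f h g = ENNReal.log (lik D π f h g) := by
  have : ∀ (s : Finset (Fin N)) (u : Fin N → ℝ≥0),
      ∑ i ∈ s, ENNReal.log (u i) = ENNReal.log ((∏ i ∈ s, u i : ℝ≥0) : ℝ≥0∞) := by
    classical
    intro s u
    induction s using Finset.induction_on with
    | empty => simp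
    | insert a s ha ih =>
      rw [Finset.sum_insert ha, Finset.prod_insert ha, ENNReal.coe_mul, ENNReal.log_mul_add, ih]
  exact this _ _

/-- Exponentiated form of the test, in which zero likelihoods need no special treatment. -/
lemma mem_confSet_iff {F : Fin H → Finset (CondDist X A ρ)} {β : ℝ} {D : Dataset H N X A ρ}
    {π : Policy H X A} {f : Fin H → CondDist X A ρ} :
    f ∈ confSet F β D π ↔ f ∈ Fintype.piFinset F ∧ ∀ h, ∀ g ∈ F h,
      (lik D π f h g : ℝ≥0∞) ≤ lik D π f h (f h) * ENNReal.ofReal (Real.exp β) := by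
  unfold confSet
  rw [Set.mem_ofPred_eq]
  refine and_congr_right fun _ => forall_congr' fun h => ?_
  rw [EReal.sub_le_iff_le_add (Or.inl (EReal.coe_ne_bot β)) (Or.inl (EReal.coe_ne_top β)),
    iSup₂_le_iff]
  refine forall₂_congr fun g _ => ?_
  have : (β : EReal) = ENNReal.log (ENNReal.ofReal (Real.exp β)) := by
    rw [ENNReal.log_ofReal_of_pos (Real.exp_pos β), Real.log_exp]
  rw [logLik_eq, logLik_eq, this, ← ENNReal.log_mul_add, ENNReal.log_le_log_iff]

/-- The regression target is distributed exactly as the Bellman backup of the candidate, so the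
maximum likelihood problem is well specified. -/
lemma lintegral_sampleLaw (M : MDP H X A) (ν : Fin H → Measure (X × A))
    (hν : ∀ h, IsProbabilityMeasure (ν h)) (π : Policy H X A) (f : Fin H → CondDist X A ρ)
    (h : Fin H) {g : CondDist X A ρ} (hg : g.kernel = bellman M h (continuation π f h))
    {G : (X × A) × ℝ → ℝ≥0∞} (hG : Measurable G) :
    ∫⁻ s, G (s.1, s.2.1.1 + s.2.2) ∂(sampleLaw M ν π f h)
      = ∫⁻ p, ∫⁻ z, G (p, z) ∂(g.kernel p) ∂(ν h) := by
  unfold sampleLaw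
  rw [Measure.lintegral_compProd (by fun_prop)]
  refine lintegral_congr fun p => ?_
  rw [hg, lintegral_bellman _ _ _ _ (by fun_prop), Kernel.lintegral_compProd _ _ _ (by fun_prop)]
  have hm : Measurable fun b : ℝ × X =>
      ∫⁻ y, G (p, b.1 + y) ∂(continuation π f h b.2) := by
    have := Measurable.lintegral_kernel_prod_right'
      (κ := (continuation π f h).comap (Prod.snd : ℝ × X → X) measurable_snd)
      (f := fun q : (ℝ × X) × ℝ => G (p, q.1.1 + q.2)) (by fun_prop)
    simpa only [Kernel.comap_apply] using this
  simp only [Kernel.comap_apply]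
  rw [Kernel.lintegral_prod _ _ _ hm]
  refine lintegral_congr fun c => ?_
  rw [Kernel.lintegral_comp _ _ _ (by fun_prop)]

section Data

variable {Ω : Type*} [MeasurableSpace Ω] {P : Measure Ω} {M : MDP H X A}
  {ν : Fin H → Measure (X × A)} {Pi : Finset (Policy H X A)} {F : Fin H → Finset (CondDist X A ρ)}
  {D : Ω → Dataset H N X A ρ} {π : Policy H X A} {f : Fin H → CondDist X A ρ} {h : Fin H}
  {g : CondDist X A ρ}

lemma IsOfflineData.measurable_target (hD : IsOfflineData P M ν Pi F D) (hπ : π ∈ Pi)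
    (hf : f ∈ Fintype.piFinset F) (h : Fin H) (i : Fin N) :
    Measurable fun ω => ((D ω).xa h i, (D ω).c h i + (D ω).y π f h i) := by
  have hφ : Measurable fun s : (X × A) × (ℝ × X) × ℝ => (s.1, s.2.1.1 + s.2.2) := by fun_prop
  exact hφ.comp ((hD π hπ f hf h).1 i)

lemma IsOfflineData.lintegral_target (hD : IsOfflineData P M ν Pi F D)
    (hν : ∀ h, IsProbabilityMeasure (ν h)) (hπ : π ∈ Pi) (hf : f ∈ Fintype.piFinset F)
    (hg : g.kernel = bellman M h (continuation π f h)) (i : Fin N)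
    {G : (X × A) × ℝ → ℝ≥0∞} (hG : Measurable G) :
    ∫⁻ ω, G ((D ω).xa h i, (D ω).c h i + (D ω).y π f h i) ∂P
      = ∫⁻ p, ∫⁻ z, G (p, z) ∂(g.kernel p) ∂(ν h) := by
  obtain ⟨hm, -, hlaw⟩ := hD π hπ f hf h
  rw [← lintegral_sampleLaw M ν hν π f h hg hG, ← hlaw i, lintegral_map (by fun_prop) (hm i)]

lemma IsOfflineData.lintegral_prod_target (hD : IsOfflineData P M ν Pi F D)
    (hν : ∀ h, IsProbabilityMeasure (ν h)) (hπ : π ∈ Pi) (hf : f ∈ Fintype.piFinset F)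
    (hg : g.kernel = bellman M h (continuation π f h))
    {G : (X × A) × ℝ → ℝ≥0∞} (hG : Measurable G) :
    ∫⁻ ω, ∏ i, G ((D ω).xa h i, (D ω).c h i + (D ω).y π f h i) ∂P
      = (∫⁻ p, ∫⁻ z, G (p, z) ∂(g.kernel p) ∂(ν h)) ^ N := by
  obtain ⟨-, hind, -⟩ := hD π hπ f hf h
  have hφ : Measurable fun s : (X × A) × (ℝ × X) × ℝ => G (s.1, s.2.1.1 + s.2.2) := by fun_prop
  have := lintegral_prod_eq_prod_lintegral_of_indepFun Finset.univ
    (fun i ω => G ((D ω).xa h i, (D ω).c h i + (D ω).y π f h i))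
    (hind.comp (fun _ => fun s => G (s.1, s.2.1.1 + s.2.2)) fun _ => hφ)
    (fun i => hG.comp (hD.measurable_target hπ hf h i))
  rw [this]
  simp_rw [hD.lintegral_target hν hπ hf hg _ hG]
  simp

lemma IsOfflineData.ae_lik_ne_zero (hD : IsOfflineData P M ν Pi F D)
    (hν : ∀ h, IsProbabilityMeasure (ν h)) (hπ : π ∈ Pi) (hf : f ∈ Fintype.piFinset F)
    (hg : g.kernel = bellman M h (continuation π f h)) :
    ∀ᵐ ω ∂P, lik (D ω) π f h g ≠ 0 := by
  have hd := g.measurable_density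
  have hS : MeasurableSet {q : (X × A) × ℝ | g.density q.1 q.2 = 0} :=
    hd (measurableSet_singleton 0)
  have hG : Measurable ({q : (X × A) × ℝ | g.density q.1 q.2 = 0}.indicator
      (1 : (X × A) × ℝ → ℝ≥0∞)) := measurable_one.indicator hS
  have hi : ∀ i, ∀ᵐ ω ∂P,
      g.density ((D ω).xa h i) ((D ω).c h i + (D ω).y π f h i) ≠ 0 := by
    intro i
    have h0 := hD.lintegral_target hν hπ hf hg i hG
    have hz : ∀ p, ∫⁻ z, {q : (X × A) × ℝ | g.density q.1 q.2 = 0}.indicator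
        (1 : (X × A) × ℝ → ℝ≥0∞) (p, z) ∂(g.kernel p) = 0 := by
      intro p
      have hGp : Measurable fun z => {q : (X × A) × ℝ | g.density q.1 q.2 = 0}.indicator
          (1 : (X × A) × ℝ → ℝ≥0∞) (p, z) := hG.comp measurable_prodMk_left
      rw [g.lintegral_kernel p hGp]
      have : ∀ z, (g.density p z : ℝ≥0∞) * {q : (X × A) × ℝ | g.density q.1 q.2 = 0}.indicator
          (1 : (X × A) × ℝ → ℝ≥0∞) (p, z) = 0 := by
        intro z
        by_cases hz : g.density p z = 0
        · simp [hz]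
        · simp [Set.indicator, hz]
      simp [this]
    simp only [hz, lintegral_zero] at h0
    have h1 := (lintegral_eq_zero_iff (hG.comp (hD.measurable_target hπ hf h i))).1 h0
    filter_upwards [h1] with ω hω hc
    simp [Set.indicator, hc] at hω
  filter_upwards [ae_all_iff.2 hi] with ω hω
  exact Finset.prod_ne_zero_iff.2 fun i _ => hω i

/-- The likelihood ratio test rejects the true conditional law with probability at most
`exp (-β)`. -/
lemma IsOfflineData.measure_lik_lt_le (hD : IsOfflineData P M ν Pi F D)
    (hν : ∀ h, IsProbabilityMeasure (ν h)) (hπ : π ∈ Pi) (hf : f ∈ Fintype.piFinset F)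
    (hg : g.kernel = bellman M h (continuation π f h)) (k : CondDist X A ρ) (β : ℝ) :
    P {ω | (lik (D ω) π f h g : ℝ≥0∞) * ENNReal.ofReal (Real.exp β) < lik (D ω) π f h k}
      ≤ ENNReal.ofReal (Real.exp (-β)) := by
  have hdg := g.measurable_density
  have hdk := k.measurable_density
  simp only [Function.uncurry_def] at hdg hdk
  set G : (X × A) × ℝ → ℝ≥0∞ :=
    fun q => ((k.density q.1 q.2 / g.density q.1 q.2 : ℝ≥0) : ℝ≥0∞) with hGdef
  have hG : Measurable G := by fun_prop
  set R : Ω → ℝ≥0∞ := fun ω => ∏ i, G ((D ω).xa h i, (D ω).c h i + (D ω).y π f h i) with hR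
  have hRm : Measurable R :=
    Finset.measurable_fun_prod _ fun i _ => hG.comp (hD.measurable_target hπ hf h i)
  have hER : ∫⁻ ω, R ω ∂P ≤ 1 := by
    rw [hR, hD.lintegral_prod_target hν hπ hf hg hG]
    refine pow_le_one₀ zero_le ?_
    calc ∫⁻ p, ∫⁻ z, G (p, z) ∂(g.kernel p) ∂(ν h) ≤ ∫⁻ _, 1 ∂(ν h) := by
          refine lintegral_mono fun p => ?_
          have hGp : Measurable fun z => G (p, z) := hG.comp measurable_prodMk_left
          rw [g.lintegral_kernel p hGp,
            ← lintegral_eq_one_of_withDensity (k.isProbabilityMeasure_withDensity p)]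
          -- Only an inequality: the mass of `k` where the density of `g` vanishes is lost.
          refine lintegral_mono fun z => ?_
          simp only [hGdef]
          rw [← ENNReal.coe_mul, ENNReal.coe_le_coe, mul_comm]
          rcases eq_or_ne (g.density p z) 0 with h0 | h0
          · simp [h0]
          · exact (div_mul_cancel₀ _ h0).le
      _ = 1 := by simp
  have hsub : P {ω | (lik (D ω) π f h g : ℝ≥0∞) * ENNReal.ofReal (Real.exp β)
      < lik (D ω) π f h k} ≤ P {ω | ENNReal.ofReal (Real.exp β) ≤ R ω} := by
    refine measure_mono_ae ?_
    filter_upwards [hD.ae_lik_ne_zero hν hπ hf hg] with ω hω hlt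
    have hprod : R ω = ((lik (D ω) π f h k / lik (D ω) π f h g : ℝ≥0) : ℝ≥0∞) := by
      simp only [hR, hGdef, lik]
      rw [← Finset.prod_div_distrib, ENNReal.ofNNReal_finsetProd]
    change ENNReal.ofReal (Real.exp β) ≤ R ω
    rw [hprod, ENNReal.coe_div hω,
      ENNReal.le_div_iff_mul_le (Or.inl (by simpa using hω)) (Or.inl ENNReal.coe_ne_top), mul_comm]
    exact le_of_lt hlt
  refine hsub.trans ?_
  have hmk := (mul_meas_ge_le_lintegral hRm (ENNReal.ofReal (Real.exp β)) (μ := P)).trans hER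
  rw [Real.exp_neg, ENNReal.ofReal_inv_of_pos (Real.exp_pos β), ← one_div,
    ENNReal.le_div_iff_mul_le (Or.inl (by simp [Real.exp_pos])) (Or.inl ENNReal.ofReal_ne_top),
    mul_comm]
  exact hmk

/-- A candidate that is far from the true conditional law passes the likelihood ratio test with
small probability. -/
lemma IsOfflineData.measure_lik_le_le (hD : IsOfflineData P M ν Pi F D) (hN : 0 < N)
    (hν : ∀ h, IsProbabilityMeasure (ν h)) (hπ : π ∈ Pi) (hf : f ∈ Fintype.piFinset F)
    (hg : g.kernel = bellman M h (continuation π f h)) (k : CondDist X A ρ) {β : ℝ} (hβ : 0 ≤ β)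
    (hfar : ENNReal.ofReal (5 * β / N) < ∫⁻ p, hell (k.kernel p) (g.kernel p) ∂(ν h)) :
    P {ω | (lik (D ω) π f h g : ℝ≥0∞) ≤ lik (D ω) π f h k * ENNReal.ofReal (Real.exp β)}
      ≤ ENNReal.ofReal (Real.exp (-(2 * β))) := by
  have hN' : (0 : ℝ) < N := by exact_mod_cast hN
  have hdg := g.measurable_density
  have hdk := k.measurable_density
  simp only [Function.uncurry_def] at hdg hdk
  set G : (X × A) × ℝ → ℝ≥0∞ :=
    fun q => (NNReal.sqrt (k.density q.1 q.2 / g.density q.1 q.2) : ℝ≥0∞) with hGdef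
  have hG : Measurable G := by fun_prop
  set R : Ω → ℝ≥0∞ := fun ω => ∏ i, G ((D ω).xa h i, (D ω).c h i + (D ω).y π f h i) with hR
  have hRm : Measurable R :=
    Finset.measurable_fun_prod _ fun i _ => hG.comp (hD.measurable_target hπ hf h i)
  set b := ∫⁻ p, ∫⁻ z, G (p, z) ∂(g.kernel p) ∂(ν h) with hb
  have haff : ∫⁻ p, affinity (k.kernel p) (g.kernel p) ∂(ν h) = 2 * b := by
    simp_rw [affinity_kernel]
    rw [lintegral_const_mul]
    exact Measurable.lintegral_kernel_prod_right' hG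
  have hle2 : 2 * b ≤ 2 := by
    rw [← haff]
    calc _ ≤ ∫⁻ _, 2 ∂(ν h) := lintegral_mono fun p => affinity_le_two _ _
      _ = 2 := by simp
  have hbtop : b ≠ ∞ := by
    rintro hbt
    rw [hbt] at hle2
    simp [ENNReal.mul_top] at hle2
  -- Here `b` is one minus half the averaged `hell`, and `1 - x ≤ exp (-x)`.
  have hbexp : b ≤ ENNReal.ofReal (Real.exp (-(5 * β / (2 * N)))) := by
    have hE : ∫⁻ p, hell (k.kernel p) (g.kernel p) ∂(ν h) = 2 - 2 * b := by
      unfold hell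
      rw [lintegral_sub (measurable_affinity k g)
        (by rw [haff]; exact (hle2.trans_lt ENNReal.ofNat_lt_top).ne)
        (Filter.Eventually.of_forall fun p => affinity_le_two _ _), haff]
      simp
    rw [hE, lt_tsub_iff_left] at hfar
    clear_value b
    lift b to ℝ≥0 using hbtop
    have h1 : 2 * (b : ℝ) + 5 * β / N < 2 := by
      have h2 : (2 * (b : ℝ≥0∞) + ENNReal.ofReal (5 * β / N)).toReal < (2 : ℝ≥0∞).toReal :=
        (ENNReal.toReal_lt_toReal (hfar.trans ENNReal.ofNat_lt_top).ne (by simp)).2 hfar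
      rw [ENNReal.toReal_add (by finiteness) (by finiteness),
        ENNReal.toReal_ofReal (by positivity)] at h2
      simpa using h2
    rw [← ENNReal.ofReal_coe_nnreal]
    refine ENNReal.ofReal_le_ofReal ?_
    have h3 := Real.add_one_le_exp (-(5 * β / (2 * N)))
    have h4 : 5 * β / (2 * N) = 5 * β / N / 2 := by field_simp
    rw [h4] at h3 ⊢
    linarith
  have hER : ∫⁻ ω, R ω ∂P ≤ ENNReal.ofReal (Real.exp (-(5 * β / 2))) := by
    rw [hR, hD.lintegral_prod_target hν hπ hf hg hG, ← hb]
    calc b ^ N ≤ ENNReal.ofReal (Real.exp (-(5 * β / (2 * N)))) ^ N := by gcongr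
      _ = ENNReal.ofReal (Real.exp (-(5 * β / 2))) := by
        rw [← ENNReal.ofReal_pow (Real.exp_pos _).le, ← Real.exp_nat_mul]
        congr 2
        field_simp
  have hsub : P {ω | (lik (D ω) π f h g : ℝ≥0∞)
      ≤ lik (D ω) π f h k * ENNReal.ofReal (Real.exp β)}
      ≤ P {ω | ENNReal.ofReal (Real.exp (-(β / 2))) ≤ R ω} := by
    refine measure_mono_ae ?_
    filter_upwards [hD.ae_lik_ne_zero hν hπ hf hg] with ω hω hle
    have hprod : R ω = (NNReal.sqrt (lik (D ω) π f h k / lik (D ω) π f h g) : ℝ≥0∞) := by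
      simp only [hR, hGdef, lik]
      rw [← Finset.prod_div_distrib, ← ENNReal.ofNNReal_finsetProd]
      congr 1
      exact (map_prod NNReal.sqrtHom _ _).symm
    change ENNReal.ofReal (Real.exp (-(β / 2))) ≤ R ω
    replace hle : (lik (D ω) π f h g : ℝ≥0∞)
      ≤ lik (D ω) π f h k * ENNReal.ofReal (Real.exp β) := hle
    set l := lik (D ω) π f h g
    set m := lik (D ω) π f h k
    have hle' : (l : ℝ) ≤ m * Real.exp β := by
      rw [← ENNReal.ofReal_coe_nnreal, ← ENNReal.ofReal_coe_nnreal,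
        ← ENNReal.ofReal_mul (NNReal.coe_nonneg m)] at hle
      exact (ENNReal.ofReal_le_ofReal_iff (by positivity)).1 hle
    rw [hprod, ← ENNReal.ofReal_coe_nnreal]
    refine ENNReal.ofReal_le_ofReal ?_
    rw [Real.coe_sqrt, NNReal.coe_div]
    have hl : (0 : ℝ) < l := by positivity
    refine Real.le_sqrt_of_sq_le ?_
    rw [← Real.exp_nat_mul, le_div_iff₀ hl]
    calc Real.exp ((2 : ℕ) * -(β / 2)) * l ≤ Real.exp ((2 : ℕ) * -(β / 2)) * (m * Real.exp β) := by
          gcongr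
      _ = m := by
          rw [mul_left_comm, ← Real.exp_add]
          have : ((2 : ℕ) : ℝ) * -(β / 2) + β = 0 := by push_cast; ring
          rw [this, Real.exp_zero, mul_one]
  refine hsub.trans ?_
  have hmk := (mul_meas_ge_le_lintegral hRm (ENNReal.ofReal (Real.exp (-(β / 2))))
    (μ := P)).trans hER
  -- Survival forces the root of the ratio above `exp (-β / 2)`; the constant 5 leaves `exp (-2 *
  -- β)` after Markov's inequality.
  have hsplit : Real.exp (-(2 * β)) = Real.exp (-(5 * β / 2)) / Real.exp (-(β / 2)) := by
    rw [← Real.exp_sub]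
    congr 1
    ring
  rw [hsplit, ENNReal.ofReal_div_of_pos (Real.exp_pos _),
    ENNReal.le_div_iff_mul_le (Or.inl (by simp [Real.exp_pos])) (Or.inl ENNReal.ofReal_ne_top),
    mul_comm]
  exact hmk

end Data

/-! ### Pessimism, the union bound and the conclusion. -/

lemma exists_isPDiscoOutput [NeZero H] (M : MDP H X A) {Pi : Finset (Policy H X A)}
    (hPi : Pi.Nonempty) {F : Fin H → Finset (CondDist X A ρ)} {β : ℝ} {D : Dataset H N X A ρ}
    (hne : ∀ π ∈ Pi, (confSet F β D π).Nonempty) : ∃ πhat, IsPDiscoOutput M Pi F β D πhat := by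
  have hmax : ∀ π, ∃ f : Fin H → CondDist X A ρ, π ∈ Pi → f ∈ confSet F β D π ∧
      ∀ f' ∈ confSet F β D π, estimate M π f' ≤ estimate M π f := by
    intro π
    by_cases hπ : π ∈ Pi
    · have hfin : (confSet F β D π).Finite :=
        (Fintype.piFinset F).finite_toSet.subset fun f hf => hf.1
      obtain ⟨f, hf, hmax⟩ := Set.exists_max_image _ (estimate M π) hfin (hne π hπ)
      exact ⟨f, fun _ => ⟨hf, hmax⟩⟩
    · obtain ⟨π', hπ'⟩ := hPi
      obtain ⟨f, -⟩ := hne π' hπ'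
      exact ⟨f, fun h => absurd h hπ⟩
  choose sel hsel using hmax
  obtain ⟨πhat, hπhat, hmin⟩ := Pi.exists_min_image (fun π => estimate M π (sel π)) hPi
  exact ⟨πhat, sel, fun π hπ => hsel π hπ, hπhat, hmin⟩

/-- The regret bound holds as soon as every confidence set contains the true conditional return
laws and all its elements have small Bellman error. -/
lemma IsPDiscoOutput.value_sub_le [NeZero H] {M : MDP H X A} {ν : Fin H → Measure (X × A)}
    (hν : ∀ h, IsProbabilityMeasure (ν h)) {Pi : Finset (Policy H X A)}
    {F : Fin H → Finset (CondDist X A ρ)} {β : ℝ} (hβ : 0 ≤ β) {D : Dataset H N X A ρ}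
    {Z : Policy H X A → Fin H → CondDist X A ρ} (hZ : ∀ π ∈ Pi, IsBellmanFixed M π (Z π))
    (hZmem : ∀ π ∈ Pi, Z π ∈ confSet F β D π)
    (herr : ∀ π ∈ Pi, ∀ f ∈ confSet F β D π, ∃ g : Fin H → CondDist X A ρ,
      (∀ h, (g h).kernel = bellman M h (continuation π f h)) ∧
      ∀ h, ∫⁻ p, hell ((f h).kernel p) ((g h).kernel p) ∂(ν h) ≤ ENNReal.ofReal (5 * β / N))
    {πhat : Policy H X A} (hhat : IsPDiscoOutput M Pi F β D πhat) {πt : Policy H X A}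
    (hπt : πt ∈ Pi) (hC : concentrability M ν πt ≠ ∞) :
    value M πhat - value M πt ≤
      10 * (H * √(returnVar M πt * (concentrability M ν πt).toReal * β / N)
        + (H : ℝ) ^ (5 / 2 : ℝ) * (concentrability M ν πt).toReal * β / N) := by
  obtain ⟨sel, hsel, hπhat, hmin⟩ := hhat
  -- Pessimism: the true laws compete in the maximum defining `sel πhat`, and `πhat` minimises the
  -- resulting estimates.
  have h1 : value M πhat ≤ estimate M πt (sel πt) := by
    rw [← estimate_fixed M πhat (hZ πhat hπhat)]
    exact ((hsel πhat hπhat).2 _ (hZmem πhat hπhat)).trans (hmin πt hπt)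
  obtain ⟨g, hg, hε⟩ := herr πt hπt _ (hsel πt hπt).1
  have h2 := estimate_sub_value_le M ν hν πt hC (hZ πt hπt) hg (by positivity) hε
  refine (sub_le_sub_right h1 _).trans (h2.trans ?_)
  set C := (concentrability M ν πt).toReal
  have hC0 : 0 ≤ C := ENNReal.toReal_nonneg
  have hV : 0 ≤ returnVar M πt := variance_nonneg _ _
  set V := returnVar M πt
  have hH : (1 : ℝ) ≤ H := by exact_mod_cast NeZero.pos H
  have e1 : V * (H ^ 2 * C * (5 * β / N)) = (H : ℝ) ^ 2 * (5 * (V * C * β / N)) := by ring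
  have h5 : √(5 : ℝ) ≤ 3 := Real.sqrt_le_iff.2 ⟨by norm_num, by norm_num⟩
  rw [e1, Real.sqrt_mul (by positivity), Real.sqrt_sq (by positivity), Real.sqrt_mul (by norm_num)]
  -- The argument yields `H ^ 2` in the lower-order term; it is relaxed here.
  have hpow : (H : ℝ) ^ 2 ≤ (H : ℝ) ^ (5 / 2 : ℝ) := by
    rw [← Real.rpow_natCast]
    exact Real.rpow_le_rpow_of_exponent_le hH (by norm_num)
  have e2 : 2 * ((H : ℝ) ^ 2 * C * (5 * β / N)) = 10 * ((H : ℝ) ^ 2 * (C * β / N)) := by ring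
  have e3 : (H : ℝ) ^ (5 / 2 : ℝ) * C * β / N = (H : ℝ) ^ (5 / 2 : ℝ) * (C * β / N) := by ring
  rw [e2, e3, mul_add]
  have hs : 0 ≤ √(V * C * β / N) := Real.sqrt_nonneg _
  refine add_le_add ?_ (by gcongr)
  calc 3 * ((H : ℝ) * (√5 * √(V * C * β / N))) ≤ 3 * ((H : ℝ) * (3 * √(V * C * β / N))) := by
        gcongr
    _ ≤ 10 * (H * √(V * C * β / N)) := by
        have : 0 ≤ (H : ℝ) * √(V * C * β / N) := by positivity
        linarith

/-- With probability at least `1 - δ`, no likelihood ratio test errs. -/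
lemma IsOfflineData.exists_good_event {Ω : Type*} [MeasurableSpace Ω] [NeZero H] (hN : 0 < N)
    {M : MDP H X A} {ν : Fin H → Measure (X × A)} (hν : ∀ h, IsProbabilityMeasure (ν h))
    {Pi : Finset (Policy H X A)} (hPi : Pi.Nonempty) {F : Fin H → Finset (CondDist X A ρ)}
    {P : Measure Ω} {D : Ω → Dataset H N X A ρ} (hD : IsOfflineData P M ν Pi F D)
    {δ : ℝ} (hδ0 : 0 < δ) (hδ1 : δ < 1) {β : ℝ} (hβ0 : 0 ≤ β)
    (hβ : β = Real.log (H * Pi.card * (Fintype.piFinset F).card / δ))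
    {Z : Policy H X A → Fin H → CondDist X A ρ} (hZ : ∀ π ∈ Pi, IsBellmanFixed M π (Z π))
    (hZF : ∀ π ∈ Pi, Z π ∈ Fintype.piFinset F)
    {g : Policy H X A → (Fin H → CondDist X A ρ) → Fin H → CondDist X A ρ}
    (hg : ∀ π ∈ Pi, ∀ f ∈ Fintype.piFinset F, ∀ h, g π f h ∈ F h ∧
      (g π f h).kernel = bellman M h (continuation π f h)) :
    ∃ E : Set Ω, P E ≤ ENNReal.ofReal δ ∧ ∀ ω, ω ∉ E →
      (∀ π ∈ Pi, Z π ∈ confSet F β (D ω) π) ∧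
      ∀ π ∈ Pi, ∀ f ∈ confSet F β (D ω) π, ∀ h,
        ∫⁻ p, hell ((f h).kernel p) ((g π f h).kernel p) ∂(ν h) ≤ ENNReal.ofReal (5 * β / N) := by
  classical
  set q := Real.exp (-β) with hq
  set n := (Fintype.piFinset F).card with hn
  have hcard : ∀ h, (F h).card ≤ n := by
    intro h
    obtain ⟨π, hπ⟩ := hPi
    have hpos : ∀ h, 0 < (F h).card := fun h =>
      Finset.card_pos.2 ⟨_, Fintype.mem_piFinset.1 (hZF π hπ) h⟩
    rw [hn, Fintype.card_piFinset]
    exact Nat.le_of_dvd (Finset.prod_pos fun h _ => hpos h)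
      (Finset.dvd_prod_of_mem _ (Finset.mem_univ h))
  have hnpos : 0 < n := by
    obtain ⟨π, hπ⟩ := hPi
    exact Finset.card_pos.2 ⟨_, hZF π hπ⟩
  -- The targets are those drawn for `Z π` itself, whose backup is `Z π`. Erasing the trivial
  -- competitor saves one event per policy and step, which pays for `E₂`.
  set E₁ : Set Ω := ⋃ π ∈ Pi, ⋃ h ∈ (Finset.univ : Finset (Fin H)), ⋃ k ∈ (F h).erase (Z π h),
    {ω | (lik (D ω) π (Z π) h (Z π h) : ℝ≥0∞) * ENNReal.ofReal (Real.exp β)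
      < lik (D ω) π (Z π) h k} with hE₁
  set E₂ : Set Ω := ⋃ π ∈ Pi, ⋃ f ∈ Fintype.piFinset F, ⋃ h ∈ (Finset.univ : Finset (Fin H)),
    {ω | ENNReal.ofReal (5 * β / N)
        < ∫⁻ p, hell ((f h).kernel p) ((g π f h).kernel p) ∂(ν h) ∧
      (lik (D ω) π f h (g π f h) : ℝ≥0∞)
        ≤ lik (D ω) π f h (f h) * ENNReal.ofReal (Real.exp β)} with hE₂
  have hP₁ : P E₁ ≤ (Pi.card * (H * (n - 1)) : ℕ) * ENNReal.ofReal q := by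
    calc P E₁ ≤ ∑ _π ∈ Pi, ∑ _h : Fin H, (n - 1) • ENNReal.ofReal q := by
          refine (measure_biUnion_finset_le _ _).trans (Finset.sum_le_sum fun π hπ => ?_)
          refine (measure_biUnion_finset_le _ _).trans (Finset.sum_le_sum fun h _ => ?_)
          refine (measure_biUnion_finset_le _ _).trans ?_
          refine (Finset.sum_le_card_nsmul _ _ (ENNReal.ofReal q) fun k _ =>
            hD.measure_lik_lt_le hν hπ (hZF π hπ) (hZ π hπ h) k β).trans ?_
          rw [Finset.card_erase_of_mem (Fintype.mem_piFinset.1 (hZF π hπ) h)]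
          exact nsmul_le_nsmul_left zero_le (Nat.sub_le_sub_right (hcard h) 1)
      _ = _ := by
          simp only [Finset.sum_const, Finset.card_univ, Fintype.card_fin, smul_smul]
          rw [nsmul_eq_mul]
  have hP₂ : P E₂ ≤ (Pi.card * (n * H) : ℕ) * ENNReal.ofReal (q * q) := by
    calc P E₂ ≤ ∑ _π ∈ Pi, ∑ _f ∈ Fintype.piFinset F, ∑ _h : Fin H, ENNReal.ofReal (q * q) := by
          refine (measure_biUnion_finset_le _ _).trans (Finset.sum_le_sum fun π hπ => ?_)
          refine (measure_biUnion_finset_le _ _).trans (Finset.sum_le_sum fun f hf => ?_)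
          refine (measure_biUnion_finset_le _ _).trans (Finset.sum_le_sum fun h _ => ?_)
          by_cases hfar : ENNReal.ofReal (5 * β / N)
              < ∫⁻ p, hell ((f h).kernel p) ((g π f h).kernel p) ∂(ν h)
          · simp only [hfar, true_and]
            refine (hD.measure_lik_le_le hN hν hπ hf (hg π hπ f hf h).2 (f h) hβ0 hfar).trans ?_
            rw [hq, ← Real.exp_add]
            exact le_of_eq (by congr 2; ring)
          · simp [hfar]
      _ = _ := by
          simp only [Finset.sum_const, Finset.card_univ, Fintype.card_fin, smul_smul]
          rw [nsmul_eq_mul]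
  have hPc : (1 : ℝ) ≤ Pi.card := by exact_mod_cast hPi.card_pos
  have hH : (1 : ℝ) ≤ H := by exact_mod_cast NeZero.pos H
  have hn1 : (1 : ℝ) ≤ n := by exact_mod_cast hnpos
  have hqeq : (H * Pi.card * n) * q = δ := by
    rw [hq, hβ, Real.exp_neg, Real.exp_log (by positivity)]
    field_simp
  refine ⟨E₁ ∪ E₂, ?_, fun ω hω => ⟨fun π hπ => ?_, fun π hπ f hf h => ?_⟩⟩
  · refine (measure_union_le _ _).trans ((add_le_add hP₁ hP₂).trans ?_)
    rw [← ENNReal.ofReal_natCast, ← ENNReal.ofReal_natCast,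
      ← ENNReal.ofReal_mul (by positivity), ← ENNReal.ofReal_mul (by positivity),
      ← ENNReal.ofReal_add (by positivity) (by positivity)]
    refine ENNReal.ofReal_le_ofReal ?_
    push_cast [Nat.cast_sub (Nat.one_le_iff_ne_zero.2 hnpos.ne')]
    have hq0 : 0 < q := Real.exp_pos _
    -- The events of `E₂` cost `δ * q` in total, less than the saving `Pi.card * H * q` in `E₁`, so
    -- the sum stays below `δ` with no extra factor inside the logarithm.
    have e : (Pi.card : ℝ) * (H * (n - 1)) * q + Pi.card * (n * H) * (q * q)
        = δ - (Pi.card * H - δ) * q := by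
      linear_combination (1 + q) * hqeq
    have : δ ≤ Pi.card * H := by nlinarith
    rw [e]
    nlinarith
  · have hω₁ : ω ∉ E₁ := fun h => hω (Or.inl h)
    refine mem_confSet_iff.2 ⟨hZF π hπ, fun h k hk => ?_⟩
    by_cases hkZ : k = Z π h
    · rw [hkZ]
      refine le_mul_of_one_le_right zero_le ?_
      rw [ENNReal.one_le_ofReal]
      exact Real.one_le_exp hβ0
    · by_contra hlt
      refine hω₁ ?_
      simp only [hE₁, Set.mem_iUnion]
      exact ⟨π, hπ, h, Finset.mem_univ h, k, Finset.mem_erase.2 ⟨hkZ, hk⟩, not_le.1 hlt⟩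
  · have hω₂ : ω ∉ E₂ := fun h => hω (Or.inr h)
    obtain ⟨hfF, hlik⟩ := mem_confSet_iff.1 hf
    by_contra hlt
    refine hω₂ ?_
    simp only [hE₂, Set.mem_iUnion]
    exact ⟨π, hπ, f, hfF, h, Finset.mem_univ h, not_le.1 hlt, hlik h _ (hg π hπ f hfF h).1⟩

end

end OfflineDistRL

open MeasureTheory ProbabilityTheory OfflineDistRL in
theorem mainTheorem2 :
    ∃ K : ℝ, 0 < K ∧
      ∀ {X A Ω : Type*} [MeasurableSpace X] [Fintype A] [MeasurableSpace A]
        [MeasurableSingletonClass A] [MeasurableSpace Ω]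
        (H N : ℕ) [NeZero H] (_ : 0 < N) (ρ : Measure ℝ)
        (M : MDP H X A) (ν : Fin H → Measure (X × A)) (_ : ∀ h, IsProbabilityMeasure (ν h))
        (Pi : Finset (Policy H X A)) (_ : Pi.Nonempty)
        (F : Fin H → Finset (CondDist X A ρ)) (_ : BellmanComplete M Pi F)
        (P : Measure Ω) (_ : IsProbabilityMeasure P)
        (D : Ω → Dataset H N X A ρ) (_ : IsOfflineData P M ν Pi F D)
        (δ : ℝ) (_ : 0 < δ) (_ : δ < 1) (β : ℝ)
        (_ : β = Real.log (H * Pi.card * (Fintype.piFinset F).card / δ)),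
        ENNReal.ofReal (1 - δ) ≤ P {ω |
          (∃ πhat, IsPDiscoOutput M Pi F β (D ω) πhat) ∧
          ∀ πhat, IsPDiscoOutput M Pi F β (D ω) πhat →
            ∀ πt ∈ Pi, concentrability M ν πt ≠ ⊤ →
              value M πhat - value M πt ≤
                K * (H * √(returnVar M πt * (concentrability M ν πt).toReal * β / N)
                  + (H : ℝ) ^ (5 / 2 : ℝ) * (concentrability M ν πt).toReal * β / N)} := by
  refine ⟨10, by norm_num, ?_⟩
  intro X A Ω _ _ _ _ _ H N _ hN ρ M ν hν Pi hPi F hF P _ D hD δ hδ0 hδ1 β hβ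
  have hZex : ∀ π, ∃ Z : Fin H → CondDist X A ρ, π ∈ Pi →
      Z ∈ Fintype.piFinset F ∧ IsBellmanFixed M π Z := by
    intro π
    by_cases hπ : π ∈ Pi
    · obtain ⟨Z, hZ⟩ := hF.exists_fixed hπ
      exact ⟨Z, fun _ => hZ⟩
    · obtain ⟨π', hπ'⟩ := hPi
      obtain ⟨Z, -⟩ := hF.exists_fixed hπ'
      exact ⟨Z, fun h => absurd h hπ⟩
  choose Z hZ using hZex
  have hgex : ∀ (π : Policy H X A) (f : Fin H → CondDist X A ρ) (h : Fin H),
      ∃ g : CondDist X A ρ, π ∈ Pi → f ∈ Fintype.piFinset F →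
        g ∈ F h ∧ g.kernel = bellman M h (continuation π f h) := by
    intro π f h
    by_cases hπf : π ∈ Pi ∧ f ∈ Fintype.piFinset F
    · obtain ⟨g, hg⟩ := hF.exists_backup hπf.1 (h := h)
        (fun hh => Fintype.mem_piFinset.1 hπf.2 ⟨h + 1, hh⟩)
      exact ⟨g, fun _ _ => hg⟩
    · exact ⟨f h, fun h1 h2 => absurd ⟨h1, h2⟩ hπf⟩
  choose g hg using hgex
  have hβ0 : 0 ≤ β := by
    obtain ⟨π, hπ⟩ := hPi
    have h1 : (1 : ℝ) ≤ H := by exact_mod_cast NeZero.pos H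
    have h2 : (1 : ℝ) ≤ Pi.card := by exact_mod_cast Finset.card_pos.2 ⟨π, hπ⟩
    have h3 : (1 : ℝ) ≤ (Fintype.piFinset F).card := by
      exact_mod_cast Finset.card_pos.2 ⟨_, (hZ π hπ).1⟩
    rw [hβ]
    refine Real.log_nonneg ((one_le_div hδ0).2 (hδ1.le.trans ?_))
    exact one_le_mul_of_one_le_of_one_le (one_le_mul_of_one_le_of_one_le h1 h2) h3
  obtain ⟨E, hE, hgood⟩ := hD.exists_good_event hN hν hPi hδ0 hδ1 hβ0 hβ
    (fun π hπ => (hZ π hπ).2) (fun π hπ => (hZ π hπ).1)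
    (fun π hπ f hf h => hg π f h hπ hf)
  -- Subadditivity suffices, so `E` need not be measurable.
  have hcompl : ENNReal.ofReal (1 - δ) ≤ P Eᶜ := by
    rw [ENNReal.ofReal_sub _ hδ0.le, ENNReal.ofReal_one, tsub_le_iff_right]
    calc (1 : ENNReal) = P (Eᶜ ∪ E) := by rw [Set.compl_union_self, measure_univ]
      _ ≤ P Eᶜ + P E := measure_union_le _ _
      _ ≤ _ := by gcongr
  refine hcompl.trans (measure_mono fun ω hω => ?_)
  obtain ⟨hmem, herr⟩ := hgood ω hω
  refine ⟨exists_isPDiscoOutput M hPi fun π hπ => ⟨_, hmem π hπ⟩,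
    fun πhat hhat πt hπt hC => hhat.value_sub_le hν hβ0 (fun π hπ => (hZ π hπ).2) hmem
      (fun π hπ f hf => ⟨g π f, fun h => (hg π f h hπ hf.1).2, herr π hπ f hf⟩) hπt hC⟩
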